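/- Let $k \le n$ be positive integers, let $<$ be the lexicographic monomial order on $\mathbb{Q}[x_1,\dots,x_n]$ with $x_1 > x_2 > \cdots > x_n$, and let $$I_{n,k} = \langle x_1^k, x_2^k, \dots, x_n^k,\ e_n, e_{n-1}, \dots, e_{n-k+1}\rangle \subseteq \mathbb{Q}[x_1,\dots,x_n],$$ where $e_r = e_r(x_1,\dots,x_n)$ is the elementary symmetric polynomial of degree $r$. Definitions. For a sequence $\gamma=(\gamma_1,\dots,\gamma_n)$ of nonnegative integers let $\gamma^*=(\gamma_n,\dots,\gamma_1)$. A semistandard skyline filling of shape $\gamma$ assigns a positive integer $T(i,r)$ to each cell $(i,r)$ (column $i$, row $r$) with $1\le i\le n$, $1\le r\le\gamma_i$, such that, with the basement convention $T(i,0)=n-i+1$: (1) $T(i,r)\le T(i,r-1)$ for all $1\le r\le\gamma_i$; (2) for $i<j$ with $\gamma_i\ge\gamma_j$ and $1\le r\le\gamma_j$, it is not the case that $T(i,r)\le T(j,r)\le T(i,r-1)$; (3) for $i<j$ with $\gamma_i<\gamma_j$ and $0\le r\le\gamma_i$, it is not the case that $T(j,r+1)\le T(i,r)\le T(j,r)$.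 The Demazure character is $$\kappa_\gamma(x_1,\dots,x_n)=\sum_T \prod_{i=1}^{n}\prod_{r=1}^{(\gamma^*)_i} x_{T(i,r)},$$ the sum over all semistandard skyline fillings $T$ of shape $\gamma^*$. For $S=\{s_1<\cdots<s_m\}\subseteq[n]$, the skip composition $\gamma(S)=(\gamma_1,\dots,\gamma_n)$ has $\gamma_{s_j}=s_j-j+1$ for $1\le j\le m$ and $\gamma_i=0$ for $i\notin S$. For a nonzero polynomial $f$ let $\mathrm{in}_<(f)$ be its leading monomial. A Gröbner basis of an ideal $I$ is a finite set $G$ of nonzero elements of $I$ such that $\{\mathrm{in}_<(g): g\in G\}$ generates the ideal $\langle\mathrm{in}_<(f): f\in I\setminus\{0\}\rangle$. It is reduced if every $g\in G$ has leading coefficient $1$ and, for all distinct $g,h\in G$, no monomial occurring in $h$ is divisible by $\mathrm{in}_<(g)$. Theorem. A Gröbner basis for $I_{n,k}$ with respect to $<$ is given by the variable powers $x_1^k,x_2^k,\dots,x_n^k$ together with the reverse Demazure characters $\kappa_{\gamma(S)^*}(x_n,x_{n-1},\dots,x_1)$ for all $S\subseteq[n-1]$ with $|S|=n-k+1$. If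 $k<n$, this Gröbner basis is reduced. -/

import Mathlib

open Finset

/-! Conventions: the variables `x_1, …, x_n` are `X 0, …, X (n-1)`, indexed by `Fin n`; a weak
composition of length `n` is a function `Fin n → ℕ`; a positive integer `v ≤ n` that is an entry of
a filling is represented by the element of `Fin n` with value `v - 1`. -/

section Groebner

variable {σ : Type*} {R : Type*} [CommSemiring R]

/-- The leading monomial `in_<(f)` (with coefficient `1`) of a nonzero polynomial `f`. -/
noncomputable def initialMonomial (m : MonomialOrder σ) (f : MvPolynomial σ R) :
    MvPolynomial σ R :=
  MvPolynomial.monomial (m.degree f) 1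

/-- The initial ideal `in_<(I)`, generated by the leading monomials of nonzero elements of `I`. -/
noncomputable def initialIdeal (m : MonomialOrder σ) (I : Ideal (MvPolynomial σ R)) :
    Ideal (MvPolynomial σ R) :=
  Ideal.span (initialMonomial m '' {f | f ∈ I ∧ f ≠ 0})

/-- `G` is a Gröbner basis of `I`: a finite set of nonzero elements of `I` whose leading monomials
generate the initial ideal of `I`. -/
structure IsGroebnerBasis (m : MonomialOrder σ) (I : Ideal (MvPolynomial σ R))
    (G : Set (MvPolynomial σ R)) : Prop where
  finite : G.Finite
  mem : ∀ g ∈ G, g ∈ I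
  ne_zero : ∀ g ∈ G, g ≠ 0
  span_initial : initialIdeal m I = Ideal.span (initialMonomial m '' G)

/-- `G` is a reduced Gröbner basis of `I`: all leading coefficients are `1`, and for distinct
`g, h ∈ G` no monomial occurring in `h` is divisible by the leading monomial of `g`. -/
structure IsReducedGroebnerBasis (m : MonomialOrder σ) (I : Ideal (MvPolynomial σ R))
    (G : Set (MvPolynomial σ R)) : Prop extends IsGroebnerBasis m I G where
  leadingCoeff_eq_one : ∀ g ∈ G, m.leadingCoeff g = 1
  not_dvd : ∀ g ∈ G, ∀ h ∈ G, g ≠ h → ∀ d ∈ h.support, ¬ m.degree g ≤ d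

end Groebner

/-- A filling of the skyline diagram of `γ`: column `i` has cells in rows `1, …, γ i`, and
`T i r` is the entry in row `r + 1` of column `i`. (Entries bounded by `n` suffice, because the
entries of a semistandard filling decrease weakly up columns from a basement entry at most `n`.) -/
abbrev SkylineFilling {n : ℕ} (γ : Fin n → ℕ) : Type :=
  (i : Fin n) → Fin (γ i) → Fin n

namespace SkylineFilling

variable {n : ℕ} {γ : Fin n → ℕ}

/-- Entries of the augmented diagram. Row `0` is the basement, which reads `n, n-1, …, 1` from left
to right; row `r ≥ 1` with `r ≤ γ i` is a cell of the diagram. (The value outside of the augmented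
diagram is never used.) -/
def entry (T : SkylineFilling γ) (i : Fin n) : ℕ → Fin n
  | 0 => Fin.rev i
  | r + 1 => if h : r < γ i then T i ⟨r, h⟩ else Fin.rev i

/-- A triple of entries `a, b, c` is a coinversion triple if `a ≤ b ≤ c`. -/
def IsCoinversionTriple (a b c : Fin n) : Prop := a ≤ b ∧ b ≤ c

/-- Semistandard skyline fillings: entries decrease weakly up each column (basement included), and
no type A triple `(i, r+1), (j, r+1), (i, r)` and no type B triple `(j, r+1), (i, r), (j, r)` is a
coinversion triple. -/
structure IsSemistandard (T : SkylineFilling γ) : Prop where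
  column : ∀ i : Fin n, ∀ r < γ i, T.entry i (r + 1) ≤ T.entry i r
  typeA : ∀ i j : Fin n, i < j → γ j ≤ γ i → ∀ r < γ j,
    ¬ IsCoinversionTriple (T.entry i (r + 1)) (T.entry j (r + 1)) (T.entry i r)
  typeB : ∀ i j : Fin n, i < j → γ i < γ j → ∀ r ≤ γ i,
    ¬ IsCoinversionTriple (T.entry j (r + 1)) (T.entry i r) (T.entry j r)

/-- The monomial `x_1^{# of 1s} x_2^{# of 2s} ⋯` of a filling (the basement is not counted). -/
noncomputable def weight (T : SkylineFilling γ) : MvPolynomial (Fin n) ℚ :=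
  ∏ i : Fin n, ∏ r : Fin (γ i), MvPolynomial.X (T i r)

end SkylineFilling

/-- The reversal `γ^* = (γ_n, …, γ_1)`. -/
def revComp {n : ℕ} (γ : Fin n → ℕ) : Fin n → ℕ := fun i => γ (Fin.rev i)

open Classical in
/-- The Demazure character `κ_γ(x_1, …, x_n)`: the generating function of the semistandard skyline
fillings of shape `γ^*`. -/
noncomputable def demazureCharacter {n : ℕ} (γ : Fin n → ℕ) : MvPolynomial (Fin n) ℚ :=
  ∑ T : SkylineFilling (revComp γ) with T.IsSemistandard, T.weight

/-- The reverse Demazure character `κ_γ(x_n, …, x_1)`. -/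
noncomputable def reverseDemazureCharacter {n : ℕ} (γ : Fin n → ℕ) : MvPolynomial (Fin n) ℚ :=
  MvPolynomial.rename Fin.rev (demazureCharacter γ)

/-- The skip composition `γ(S)` of `S = {s_1 < ⋯ < s_m} ⊆ [n]`: its part in position `s_j` is
`s_j - j + 1 = s_j - #{t ∈ S : t < s_j}`, and its other parts are `0`. The element `i : Fin n`
stands for `i + 1 ∈ [n]`. -/
def skipComposition {n : ℕ} (S : Finset (Fin n)) : Fin n → ℕ := fun i =>
  if i ∈ S then ((i : ℕ) + 1) - #{t ∈ S | t < i} else 0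

/-- The ideal `I_{n,k} = ⟨x_1^k, …, x_n^k, e_n, e_{n-1}, …, e_{n-k+1}⟩` of `ℚ[x_1, …, x_n]`. -/
noncomputable def idealI (n k : ℕ) : Ideal (MvPolynomial (Fin n) ℚ) :=
  Ideal.span
    (Set.range (fun i : Fin n => (MvPolynomial.X i : MvPolynomial (Fin n) ℚ) ^ k) ∪
      {f | ∃ r : ℕ, n - k + 1 ≤ r ∧ r ≤ n ∧ f = MvPolynomial.esymm (Fin n) ℚ r})

/-- The variable powers `x_1^k, …, x_n^k` together with the reverse Demazure characters
`κ_{γ(S)^*}(x_n, …, x_1)` for `S ⊆ [n-1]` with `|S| = n - k + 1`. -/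
noncomputable def groebnerSet (n k : ℕ) : Set (MvPolynomial (Fin n) ℚ) :=
  Set.range (fun i : Fin n => (MvPolynomial.X i : MvPolynomial (Fin n) ℚ) ^ k) ∪
    {f | ∃ S : Finset (Fin n), (∀ i ∈ S, (i : ℕ) + 1 ≤ n - 1) ∧ #S = n - k + 1 ∧
      f = reverseDemazureCharacter (revComp (skipComposition S))}

/-! The proof has three ingredients: the Demazure characters lie in the ideal, their leading
monomials are explicit, and a count shows that no leading monomial is missing.

Membership. In a skip composition the nonzero parts increase weakly, so taller columns stand to the
right. The type B condition then says that the entries of a row used by the taller columns are the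
service times of a queue whose customers come from the row above. A semistandard filling is
therefore the same thing as its list of row sets, a multiline queue (`levelSet_rowSet`,
`eq_of_rowSet_eq`, `exists_isSemistandard`). Exchanging two adjacent rows is invertible and
preserves the weight, and interchangeability of queues in tandem lets the exchanges be iterated
(`rectify`). The result is a chain of sets under dominance with prescribed bounds, that is, a
flagged tableau. Hence the character is a flagged Schur polynomial (`sum_weight_eq_chainSum`), equal
to a determinant (`det_flaggedMatrix`) whose first row is `e_{n-k+1}, …, e_n`. Expansion along that
row gives membership, and the ideal is stable under reversing the variables.

Leading monomials. Entries do not exceed the basement entry of their column, so after reversal the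
lexicographically largest filling repeats the basement entry all the way up each column. It is the
only filling with that monomial, which is `x^γ(S)` with coefficient `1`
(`degree_reverseDemazureCharacter`).

Counting. The monomials divisible by no `x_i^k` and no `x^γ(S)` are at most as many as the
surjections from `n` to `k` letters (`card_nonskip_le`). Conversely, take as points of `ℚ^n` the
words using every letter `0, …, k-1`. Each homogeneous component of an element of the ideal agrees
on these points with a polynomial of lower degree, so the standard monomials of the ideal span all
functions on the points, and there are at least as many of them as surjections
(`card_surjective_le_card`). A leading monomial of the ideal missed by the proposed basis would
contradict these two bounds.

Reducedness follows from bounds on the exponents occurring in a character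
(`apply_lt_of_mem_support`, `eq_of_skipExponent_le`). -/

/-! ### Discrete-time queues and their interchangeability. -/

section Queue

/-- The number of elements of `A` that are smaller than `v`. -/
def cnt (A : Finset ℕ) (v : ℕ) : ℕ := #{a ∈ A | a < v}

@[simp] lemma cnt_zero (A : Finset ℕ) : cnt A 0 = 0 := by simp [cnt]

lemma cnt_succ (A : Finset ℕ) (v : ℕ) : cnt A (v + 1) = cnt A v + if v ∈ A then 1 else 0 := by
  unfold cnt
  split_ifs with h
  · have : {a ∈ A | a < v + 1} = insert v {a ∈ A | a < v} := by
      ext a; simp only [mem_filter, mem_insert]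
      constructor
      · rintro ⟨h1, h2⟩
        rcases Nat.lt_succ_iff_lt_or_eq.1 h2 with h3 | h3
        · exact Or.inr ⟨h1, h3⟩
        · exact Or.inl h3
      · rintro (rfl | ⟨h1, h2⟩)
        · exact ⟨h, Nat.lt_succ_self _⟩
        · exact ⟨h1, by omega⟩
    rw [this, card_insert_of_notMem (by simp)]
  · rw [add_zero]
    congr 1
    ext a; simp only [mem_filter]
    constructor
    · rintro ⟨h1, h2⟩
      refine ⟨h1, lt_of_le_of_ne (by omega) ?_⟩
      rintro rfl; exact h h1
    · rintro ⟨h1, h2⟩; exact ⟨h1, by omega⟩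

lemma cnt_le_card (A : Finset ℕ) (v : ℕ) : cnt A v ≤ #A := card_filter_le _ _

lemma cnt_eq_card_iff (A : Finset ℕ) (v : ℕ) : cnt A v = #A ↔ ∀ a ∈ A, a < v := by
  unfold cnt
  rw [card_filter_eq_iff]

lemma cnt_mono (A : Finset ℕ) {v w : ℕ} (h : v ≤ w) : cnt A v ≤ cnt A w :=
  card_le_card fun a => by simp only [mem_filter]; rintro ⟨h1, h2⟩; exact ⟨h1, by omega⟩

lemma cnt_subset {A B : Finset ℕ} (h : A ⊆ B) (v : ℕ) : cnt A v ≤ cnt B v :=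
  card_le_card (filter_subset_filter _ h)

lemma cnt_union {A B : Finset ℕ} (h : Disjoint A B) (v : ℕ) :
    cnt (A ∪ B) v = cnt A v + cnt B v := by
  unfold cnt
  rw [filter_union, card_union_of_disjoint (disjoint_filter_filter h)]

lemma cnt_sdiff {A B : Finset ℕ} (h : B ⊆ A) (v : ℕ) : cnt (A \ B) v + cnt B v = cnt A v := by
  rw [← cnt_union sdiff_disjoint, sdiff_union_of_subset h]

lemma ext_of_cnt {A B : Finset ℕ} (h : ∀ v, cnt A v = cnt B v) : A = B := by
  ext v
  have h1 := h (v + 1)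
  rw [cnt_succ, cnt_succ, h v] at h1
  by_cases ha : v ∈ A <;> by_cases hb : v ∈ B <;> simp_all

/-- The queue length after the times `0, …, v - 1`, for arrivals `C` and services `R`; a customer
may be served at the time of arrival. -/
def queue (R C : Finset ℕ) : ℕ → ℕ
  | 0 => 0
  | v + 1 => queue R C v + (if v ∈ C then 1 else 0) - (if v ∈ R then 1 else 0)

/-- The set of times at which the queue with arrivals `C` and services `R` serves a customer. -/
def serve (R C : Finset ℕ) : Finset ℕ := {v ∈ R | 0 < queue R C v + if v ∈ C then 1 else 0}

lemma mem_serve {R C : Finset ℕ} {v : ℕ} :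
    v ∈ serve R C ↔ v ∈ R ∧ 0 < queue R C v + if v ∈ C then 1 else 0 := by simp [serve]

lemma serve_subset (R C : Finset ℕ) : serve R C ⊆ R := filter_subset _ _

lemma cnt_serve_add_queue (R C : Finset ℕ) (v : ℕ) :
    cnt (serve R C) v + queue R C v = cnt C v := by
  induction v with
  | zero => simp [queue]
  | succ v ih =>
    rw [cnt_succ, cnt_succ, queue]
    simp only [mem_serve]
    split_ifs <;> first | omega | simp_all

lemma cnt_serve_le (R C : Finset ℕ) (v : ℕ) : cnt (serve R C) v ≤ cnt C v := by
  have := cnt_serve_add_queue R C v; omega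

lemma cnt_serve_eq {R C : Finset ℕ} {v : ℕ} (h : v ∈ R) (h' : v ∉ serve R C) :
    cnt (serve R C) v = cnt C v ∧ v ∉ C := by
  have := cnt_serve_add_queue R C v
  rw [mem_serve] at h'
  by_cases hc : v ∈ C
  · simp [h, hc] at h'
  · simp [h, hc] at h'
    exact ⟨by omega, hc⟩

/-- A service time stays idle only when nobody is waiting, and this forces the served set by
induction on time. The criterion is what identifies a set of entries of a filling as the output of a
queue. -/
lemma serve_unique {R C M : Finset ℕ} (h1 : M ⊆ R) (h2 : ∀ v, cnt M v ≤ cnt C v)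
    (h3 : ∀ v ∈ R, v ∉ M → cnt M (v + 1) = cnt C (v + 1)) : serve R C = M := by
  apply ext_of_cnt
  intro v
  induction v with
  | zero => simp
  | succ v ih =>
    have hq := cnt_serve_add_queue R C v
    have h2' := h2 (v + 1)
    have h3' := h3 v
    rw [cnt_succ, cnt_succ] at h2' h3'
    rw [cnt_succ, cnt_succ, ih]
    congr 1
    simp only [mem_serve]
    by_cases hM : v ∈ M
    · have hR := h1 hM
      simp only [hM, hR, if_true, true_and] at *
      rw [if_pos (by omega)]
    · by_cases hR : v ∈ R
      · simp only [hM, hR, if_false, true_and, forall_true_left, not_false_eq_true] at *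
        rw [if_neg (by omega)]
      · simp [hM, hR]

lemma card_serve_le (R C : Finset ℕ) : #(serve R C) ≤ #C := by
  obtain ⟨v, hv⟩ : ∃ v, ∀ a ∈ serve R C, a < v :=
    ⟨(serve R C).sup id + 1, fun a ha => Nat.lt_succ_of_le (le_sup (f := id) ha)⟩
  rw [← (cnt_eq_card_iff _ _).2 hv]
  exact (cnt_serve_le R C v).trans (cnt_le_card _ _)

lemma queue_mono (R : Finset ℕ) {C C' : Finset ℕ} (h : C ⊆ C') (v : ℕ) :
    queue R C v ≤ queue R C' v := by
  induction v with
  | zero => simp [queue]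
  | succ v ih =>
    have := @h v
    rw [queue, queue]
    split_ifs <;> first | omega | simp_all

lemma serve_mono (R : Finset ℕ) {C C' : Finset ℕ} (h : C ⊆ C') : serve R C ⊆ serve R C' := by
  intro v
  have := @h v
  have := queue_mono R h v
  rw [mem_serve, mem_serve]
  split_ifs <;> first | exact fun h => ⟨h.1, by omega⟩ | simp_all

/-- Interchangeability of queues in tandem. -/
lemma serve_interchange (A R C : Finset ℕ) :
    serve A (serve R C) = serve (serve A R) (serve (R ∪ (A \ serve A R)) C) := by
  set M := serve A R with hM
  set N := R ∪ (A \ M) with hN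
  -- The first equation, equality of the total number of waiting customers in the two tandems, is
  -- what is wanted. The two inequalities and the alternative only make the induction close.
  have key : ∀ v,
      queue A (serve R C) v + queue R C v = queue M (serve N C) v + queue N C v ∧
      queue A (serve R C) v ≤ queue A R v ∧ queue A (serve R C) v ≤ queue M (serve N C) v ∧
      (queue A R v = queue A (serve R C) v ∨ queue M (serve N C) v = queue A (serve R C) v) := by
    intro v
    induction v with
    | zero => simp [queue]
    | succ v ih =>
      simp only [queue, mem_serve, hN, mem_union, mem_sdiff, hM] at ih ⊢
      rw [← hM, ← hN] at ih ⊢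
      by_cases hA : v ∈ A <;> by_cases hR : v ∈ R <;> by_cases hC : v ∈ C <;>
        simp only [hA, hR, hC, if_true, if_false, true_and, false_and, true_or, or_false, and_true,
          false_or, not_false_eq_true] <;>
        (try split_ifs) <;> omega
  apply ext_of_cnt
  intro v
  have h1 := cnt_serve_add_queue A (serve R C) v
  have h2 := cnt_serve_add_queue R C v
  have h3 := cnt_serve_add_queue M (serve N C) v
  have h4 := cnt_serve_add_queue N C v
  have := key v
  omega

end Queue

/-! ### The exchange of two adjacent rows and its inverse. -/

section Swap

/-- The exchange of two adjacent rows: `R` is served completely by `A`, at the times `M`, and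
the rows `A` (below) and `R` (above) are replaced by `M` (below) and `N` (above). -/
structure Swap (A R M N : Finset ℕ) : Prop where
  subset : M ⊆ A
  eq_union : N = R ∪ (A \ M)
  card_eq : #M = #R
  cnt_le : ∀ v, cnt M v ≤ cnt R v
  tight : ∀ v ∈ A, v ∉ M → cnt M v = cnt R v ∧ v ∉ R

lemma swap_serve {A R : Finset ℕ} (h : #(serve A R) = #R) :
    Swap A R (serve A R) (R ∪ (A \ serve A R)) :=
  ⟨serve_subset _ _, rfl, h, cnt_serve_le _ _, fun _ h1 h2 => cnt_serve_eq h1 h2⟩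

namespace Swap

variable {A R M N : Finset ℕ}

lemma serve_eq (h : Swap A R M N) : serve A R = M := by
  refine serve_unique h.subset h.cnt_le fun v h1 h2 => ?_
  rw [cnt_succ, cnt_succ, if_neg h2, if_neg (h.tight v h1 h2).2, (h.tight v h1 h2).1]

lemma disjoint (h : Swap A R M N) : Disjoint R (A \ M) := by
  rw [disjoint_right]
  intro v hv
  rw [mem_sdiff] at hv
  exact (h.tight v hv.1 hv.2).2

lemma cnt_add (h : Swap A R M N) (v : ℕ) : cnt N v + cnt M v = cnt R v + cnt A v := by
  rw [h.eq_union, cnt_union h.disjoint, add_assoc, cnt_sdiff h.subset]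

lemma card_right (h : Swap A R M N) : #N = #A := by
  have := card_sdiff_add_card_eq_card h.subset
  rw [h.eq_union, card_union_of_disjoint h.disjoint]
  have := h.card_eq
  omega

lemma right_sdiff (h : Swap A R M N) : N \ R = A \ M := by
  rw [h.eq_union, union_sdiff_left, sdiff_eq_self_of_disjoint h.disjoint.symm]

lemma left_eq (h : Swap A R M N) : A = M ∪ (N \ R) := by
  rw [h.right_sdiff, union_sdiff_of_subset h.subset]

lemma subset_right (h : Swap A R M N) : R ⊆ N := by
  rw [h.eq_union]; exact subset_union_left

lemma bounded (h : Swap A R M N) {w : ℕ} (hw : ∀ a ∈ M, a < w) : ∀ a ∈ R, a < w := by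
  rw [← cnt_eq_card_iff] at hw ⊢
  have := h.cnt_le w
  have := cnt_le_card R w
  have := h.card_eq
  omega

lemma prod_mul {K : Type*} [CommMonoid K] (h : Swap A R M N) (y : ℕ → K) :
    (∏ a ∈ N, y a) * ∏ a ∈ M, y a = (∏ a ∈ R, y a) * ∏ a ∈ A, y a := by
  rw [h.eq_union, prod_union h.disjoint, mul_assoc, prod_sdiff h.subset]

/-- `R` is recovered from `M` and `N` by reading times downwards, starting beyond all elements,
where both counts equal `#M`. If the counts agree up to `v` inclusive and `v` lies in `R` only, then
`v` is idle for the other pair, and tightness there contradicts `cnt M v ≤ cnt R v`. -/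
lemma left_unique {A' R' : Finset ℕ} (h : Swap A R M N) (h' : Swap A' R' M N) :
    A = A' ∧ R = R' := by
  obtain ⟨B, hB⟩ : ∃ B, ∀ a ∈ N, a < B :=
    ⟨N.sup id + 1, fun a ha => Nat.lt_succ_of_le (le_sup (f := id) ha)⟩
  have aux : ∀ {A R A' R' : Finset ℕ} {v : ℕ}, Swap A R M N → Swap A' R' M N →
      cnt R (v + 1) = cnt R' (v + 1) → v ∈ R → v ∈ R' := by
    intro A R A' R' v h h' he hv
    by_contra hv'
    have h1 : v ∈ A' \ M := by
      rw [← h'.right_sdiff, mem_sdiff]; exact ⟨h.subset_right hv, hv'⟩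
    rw [mem_sdiff] at h1
    have h2 := h'.tight v h1.1 h1.2
    have h3 := h.cnt_le v
    rw [cnt_succ, cnt_succ, if_pos hv, if_neg hv'] at he
    omega
  have key : ∀ j v, B ≤ v + j → cnt R v = cnt R' v := by
    intro j
    induction j with
    | zero =>
      intro v hv
      rw [(cnt_eq_card_iff R v).2 fun a ha => lt_of_lt_of_le (hB a (h.subset_right ha)) hv,
        (cnt_eq_card_iff R' v).2 fun a ha => lt_of_lt_of_le (hB a (h'.subset_right ha)) hv,
        ← h.card_eq, ← h'.card_eq]
    | succ j ih =>
      intro v hv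
      have h1 := ih (v + 1) (by omega)
      have h2 : v ∈ R ↔ v ∈ R' := ⟨aux h h' h1, aux h' h h1.symm⟩
      rw [cnt_succ, cnt_succ] at h1
      simp only [h2] at h1
      omega
  have hR : R = R' := ext_of_cnt fun v => key B v (by omega)
  subst hR
  exact ⟨by rw [h.left_eq, h'.left_eq], rfl⟩

end Swap

/-- The reflection of a set of natural numbers smaller than `B`. -/
def reflect (B : ℕ) (A : Finset ℕ) : Finset ℕ := {v ∈ range B | B - 1 - v ∈ A}

lemma mem_reflect {B v : ℕ} {A : Finset ℕ} : v ∈ reflect B A ↔ v < B ∧ B - 1 - v ∈ A := by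
  simp [reflect]

lemma cnt_reflect {B : ℕ} {A : Finset ℕ} (hA : ∀ a ∈ A, a < B) {v : ℕ} (hv : v ≤ B) :
    cnt (reflect B A) v + cnt A (B - v) = #A := by
  induction v with
  | zero => simp [(cnt_eq_card_iff A B).2 hA]
  | succ v ih =>
    have h1 := ih (by omega)
    have h2 : B - v = B - (v + 1) + 1 := by omega
    rw [h2, cnt_succ] at h1
    rw [cnt_succ]
    have h3 : v ∈ reflect B A ↔ B - (v + 1) ∈ A := by
      rw [mem_reflect, show B - 1 - v = B - (v + 1) by omega]
      exact ⟨fun h => h.2, fun h => ⟨by omega, h⟩⟩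
    simp only [h3]
    omega

lemma card_reflect {B : ℕ} {A : Finset ℕ} (hA : ∀ a ∈ A, a < B) : #(reflect B A) = #A := by
  have := cnt_reflect hA (le_refl B)
  rw [(cnt_eq_card_iff _ B).2 fun a ha => (mem_reflect.1 ha).1] at this
  simpa using this

/-- The hypothesis compares the arrivals and services that remain from time `v` on. The induction
keeps the stronger bound in which the customers already waiting are added to the remaining arrivals.
-/
lemma queue_eq_zero {R C : Finset ℕ} {B : ℕ}
    (h : ∀ v ≤ B, #C + cnt R v ≤ #R + cnt C v) (hR : cnt R B = #R) : queue R C B = 0 := by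
  have key : ∀ v ≤ B, queue R C v + #C + cnt R v ≤ #R + cnt C v := by
    intro v
    induction v with
    | zero => intro _; simpa [queue] using h 0 (Nat.zero_le _)
    | succ v ih =>
      intro hv
      have h1 := ih (by omega)
      have h2 := h (v + 1) hv
      rw [cnt_succ, cnt_succ] at h2 ⊢
      rw [queue]
      omega
  have := key B le_rfl
  have := cnt_le_card C B
  omega

/-- The inverse exchange is the queue run backwards in time: in reflected time the customers `M` are
served by `N`, and the times used form `R`. Dominance of `M` by `N` says exactly that the reversed
queue empties, so `R` has the size of `M`. -/
lemma exists_swap_of_cnt_le {M N : Finset ℕ} (h : ∀ v, cnt M v ≤ cnt N v) : ∃ A R, Swap A R M N := by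
  obtain ⟨B, hB⟩ : ∃ B, ∀ a ∈ M ∪ N, a < B :=
    ⟨(M ∪ N).sup id + 1, fun a ha => Nat.lt_succ_of_le (le_sup (f := id) ha)⟩
  have hM : ∀ a ∈ M, a < B := fun a ha => hB a (mem_union_left _ ha)
  have hN : ∀ a ∈ N, a < B := fun a ha => hB a (mem_union_right _ ha)
  set P := serve (reflect B N) (reflect B M) with hP
  have hPB : ∀ a ∈ P, a < B := fun a ha => (mem_reflect.1 (serve_subset _ _ ha)).1
  have hq : queue (reflect B N) (reflect B M) B = 0 := by
    apply queue_eq_zero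
    · intro v hv
      have h1 := cnt_reflect hM hv
      have h2 := cnt_reflect hN hv
      have h3 := h (B - v)
      rw [card_reflect hM, card_reflect hN]
      omega
    · rw [cnt_eq_card_iff]; exact fun a ha => (mem_reflect.1 ha).1
  have hcard : #P = #M := by
    have := cnt_serve_add_queue (reflect B N) (reflect B M) B
    rw [hq, ← hP, (cnt_eq_card_iff _ B).2 hPB,
      (cnt_eq_card_iff _ B).2 fun a ha => (mem_reflect.1 ha).1, card_reflect hM] at this
    exact this
  set R := reflect B P with hR
  have hRN : R ⊆ N := by
    intro v hv
    have h1 := mem_reflect.1 hv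
    have h2 := mem_reflect.1 (serve_subset _ _ h1.2)
    rw [show B - 1 - (B - 1 - v) = v by omega] at h2
    exact h2.2
  have hRB : ∀ a ∈ R, a < B := fun a ha => hN a (hRN ha)
  have hRc : #R = #M := by rw [hR, card_reflect hPB, hcard]
  have tight : ∀ v ∈ N, v ∉ R → cnt M v = cnt R v ∧ v ∉ M := by
    intro v hv hv'
    have hvB := hN v hv
    have h1 : B - 1 - v ∈ reflect B N := by
      rw [mem_reflect, show B - 1 - (B - 1 - v) = v by omega]
      exact ⟨by omega, hv⟩
    have h2 : B - 1 - v ∉ P := fun h => hv' (mem_reflect.2 ⟨hvB, h⟩)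
    have h3 := cnt_serve_eq h1 h2
    have h4 : v ∉ M := by
      intro h
      apply h3.2
      rw [mem_reflect, show B - 1 - (B - 1 - v) = v by omega]
      exact ⟨by omega, h⟩
    refine ⟨?_, h4⟩
    have h5 := cnt_reflect hM (v := B - 1 - v) (by omega)
    have h6 := cnt_reflect hPB (v := v + 1) (by omega)
    rw [show B - (B - 1 - v) = v + 1 by omega, cnt_succ, if_neg h4] at h5
    rw [← hR, cnt_succ, if_neg hv', show B - (v + 1) = B - 1 - v by omega] at h6
    rw [← hP] at h3
    omega
  refine ⟨M ∪ (N \ R), R, subset_union_left, ?_, hRc.symm, ?_, ?_⟩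
  · have : (M ∪ N \ R) \ M = N \ R := by
      rw [union_sdiff_left, sdiff_eq_self_of_disjoint]
      rw [disjoint_left]
      intro v hv
      rw [mem_sdiff] at hv
      exact (tight v hv.1 hv.2).2
    rw [this, union_sdiff_of_subset hRN]
  · intro v
    rcases le_or_gt v B with hv | hv
    · have h1 := cnt_reflect hPB hv
      have h2 := cnt_reflect hM (v := B - v) (by omega)
      have h3 := cnt_serve_le (reflect B N) (reflect B M) (B - v)
      have h4 := cnt_reflect hPB (v := v) hv
      rw [show B - (B - v) = v by omega] at h2
      rw [← hP] at h3
      rw [← hR] at h1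
      omega
    · rw [(cnt_eq_card_iff M v).2 fun a ha => (hM a ha).trans hv,
        (cnt_eq_card_iff R v).2 fun a ha => (hRB a ha).trans hv, hRc]
  · intro v hv hv'
    rw [mem_union, mem_sdiff] at hv
    have := hv.resolve_left hv'
    refine ⟨(tight v this.1 this.2).1, this.2⟩

/-- Passing a row through two rows of a chain preserves dominance of the two rows. -/
lemma Swap.chain {A R M N B M' N' : Finset ℕ} (h : Swap A R M N) (h' : Swap B M M' N')
    (hc : ∀ v, cnt B v ≤ cnt A v) (v : ℕ) : cnt N' v ≤ cnt N v := by
  -- This compares idle times: `B \ M'` has at most as many elements below `v` as `A \ M`. At an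
  -- idle time of `B` all of `M` so far has been served, so the comparison reduces to `hc`; at other
  -- times it persists.
  have key : ∀ v, cnt B v + cnt M v ≤ cnt A v + cnt M' v := by
    intro v
    induction v with
    | zero => simp
    | succ v ih =>
      have h1 := hc (v + 1)
      have h2 := h'.tight v
      have h3 := @h.subset v
      have h4 := @h'.subset v
      rw [cnt_succ, cnt_succ] at h1
      rw [cnt_succ, cnt_succ, cnt_succ, cnt_succ]
      by_cases hA : v ∈ A <;> by_cases hB : v ∈ B <;> by_cases hM : v ∈ M <;>
        by_cases hM' : v ∈ M' <;> simp_all <;> omega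
  have h1 := key v
  have h2 := h.cnt_add v
  have h3 := h'.cnt_add v
  have h4 := h.cnt_le v
  omega

/-- The comparison of idle times used for `Swap.chain` is now proved from large `v` downwards. At an
idle time of `A` tightness gives `cnt N v = cnt A v`, so it reduces to `hc`; at other times it
passes from `v + 1` to `v`. -/
lemma Swap.chain_symm {A R M N B M' N' : Finset ℕ} (h : Swap A R M N) (h' : Swap B M M' N')
    (hc : ∀ v, cnt N' v ≤ cnt N v) (v : ℕ) : cnt B v ≤ cnt A v := by
  obtain ⟨b, hb⟩ : ∃ b, ∀ a ∈ M ∪ R ∪ A ∪ B ∪ M', a < b :=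
    ⟨(M ∪ R ∪ A ∪ B ∪ M').sup id + 1, fun a ha => Nat.lt_succ_of_le (le_sup (f := id) ha)⟩
  have key : ∀ j v, b ≤ v + j → cnt B v + cnt M v ≤ cnt A v + cnt M' v := by
    intro j
    induction j with
    | zero =>
      intro v hv
      have e : ∀ X ⊆ M ∪ R ∪ A ∪ B ∪ M', cnt X v = #X := fun X hX =>
        (cnt_eq_card_iff _ _).2 fun a ha => by have := hb a (hX ha); omega
      have e1 := e M (by intro; simp +contextual)
      have e2 := e R (by intro; simp +contextual)
      have := h.cnt_add v
      have := h'.cnt_add v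
      have := h.card_eq
      have := hc v
      omega
    | succ j ih =>
      intro v hv
      have h1 := ih (v + 1) (by omega)
      by_cases hv1 : v ∈ A ∧ v ∉ M
      · have h2 := h.tight v hv1.1 hv1.2
        have := h.cnt_add v
        have := h'.cnt_add v
        have := hc v
        omega
      · have h3 := @h.subset v
        have h4 := @h'.subset v
        rw [cnt_succ, cnt_succ, cnt_succ, cnt_succ] at h1
        by_cases hA : v ∈ A <;> by_cases hB : v ∈ B <;> by_cases hM : v ∈ M <;>
          by_cases hM' : v ∈ M' <;> simp_all <;> omega
  have h1 := key b v (by omega)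
  have h2 := h'.cnt_le v
  omega

end Swap

/-! ### Rectification: a weight-preserving bijection from multiline queues to flagged tableaux. -/

section Rows

/-- Customers arriving at the times `C` pass through the rows of a list, from its head on. -/
def passThrough : List (Finset ℕ) → Finset ℕ → Finset ℕ
  | [], C => C
  | A :: L, C => passThrough L (serve A C)

/-- A new row is exchanged with all rows of a list, from its head on. -/
def insertRow : Finset ℕ → List (Finset ℕ) → List (Finset ℕ)
  | R, [] => [R]
  | R, A :: L => (R ∪ (A \ serve A R)) :: insertRow (serve A R) L

/-- The rows of a list, its last row first, are inserted one after the other. -/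
def rectify : List (Finset ℕ) → List (Finset ℕ)
  | [] => []
  | R :: L => insertRow R (rectify L)

@[simp] lemma length_insertRow (R : Finset ℕ) (L : List (Finset ℕ)) :
    (insertRow R L).length = L.length + 1 := by
  induction L generalizing R with
  | nil => rfl
  | cons A L ih => simp [insertRow, ih]

@[simp] lemma length_rectify (L : List (Finset ℕ)) : (rectify L).length = L.length := by
  induction L with
  | nil => rfl
  | cons A L ih => simp [rectify, ih]

/-- Iterated interchangeability. It ensures that rectifying the lower rows does not change what
happens to a row passing through them from above. -/
lemma passThrough_insertRow (R : Finset ℕ) (L : List (Finset ℕ)) (C : Finset ℕ) :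
    passThrough (insertRow R L) C = passThrough L (serve R C) := by
  induction L generalizing R C with
  | nil => rfl
  | cons A L ih => rw [insertRow, passThrough, ih, passThrough, ← serve_interchange]

lemma passThrough_rectify (L : List (Finset ℕ)) (C : Finset ℕ) :
    passThrough (rectify L) C = passThrough L C := by
  induction L generalizing C with
  | nil => rfl
  | cons A L ih => rw [rectify, passThrough_insertRow, ih, passThrough]

lemma card_passThrough_le (L : List (Finset ℕ)) (C : Finset ℕ) : #(passThrough L C) ≤ #C := by
  induction L generalizing C with
  | nil => rfl
  | cons A L ih => exact (ih _).trans (card_serve_le _ _)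

lemma card_serve_of_card_passThrough {A : Finset ℕ} {L : List (Finset ℕ)} {C : Finset ℕ}
    (h : #(passThrough (A :: L) C) = #C) :
    #(serve A C) = #C ∧ #(passThrough L (serve A C)) = #(serve A C) := by
  have h1 := card_passThrough_le L (serve A C)
  have h2 := card_serve_le A C
  rw [passThrough] at h
  omega

lemma bounded_of_passThrough {L : List (Finset ℕ)} {C : Finset ℕ} {b : ℕ}
    (h : #(passThrough L C) = #C) (hb : ∀ a ∈ passThrough L C, a < b) : ∀ a ∈ C, a < b := by
  induction L generalizing C with
  | nil => exact hb
  | cons A L ih =>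
    have h1 := card_serve_of_card_passThrough h
    exact (swap_serve h1.1).bounded (ih h1.2 hb)

variable (ℓ w : ℕ → ℕ)

/-- A list of rows, the top row first, such that each row passes completely through the rows below
it and leaves them in a set bounded by `w`. The row with index `i` has `ℓ i` elements. -/
def IsQueueList : List (Finset ℕ) → Prop
  | [] => True
  | R :: L => IsQueueList L ∧ #R = ℓ L.length ∧ #(passThrough L R) = #R ∧
      ∀ a ∈ passThrough L R, a < w L.length

/-- A list of sets with sizes `ℓ i, ℓ (i + 1), …`, bounded by `w i, w (i + 1), …`, such that each
one dominates the preceding one: the columns of a flagged semistandard tableau. -/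
def IsChainList : ℕ → List (Finset ℕ) → Prop
  | _, [] => True
  | i, A :: L => #A = ℓ i ∧ (∀ a ∈ A, a < w i) ∧ (∀ B ∈ L.head?, ∀ v, cnt B v ≤ cnt A v) ∧
      IsChainList (i + 1) L

variable {ℓ w}

/-- Dominance between consecutive new rows is `Swap.chain`, except at the end of the list, where it
follows from the sizes of the two exchanged rows. A completely served set inherits any bound on its
service times, which gives the bounds since `w` is antitone. -/
lemma isChainList_insertRow (hw : Antitone w) {L : List (Finset ℕ)} {i : ℕ} {R : Finset ℕ}
    (hL : IsChainList ℓ w i L) (hR : #R = ℓ (i + L.length))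
    (h : #(passThrough L R) = #R) (hb : ∀ a ∈ passThrough L R, a < w (i + L.length)) :
    IsChainList ℓ w i (insertRow R L) := by
  induction L generalizing i R with
  | nil => simp_all [insertRow, IsChainList, passThrough]
  | cons A L ih =>
    have h1 := card_serve_of_card_passThrough h
    have hs := swap_serve h1.1
    have hRb := bounded_of_passThrough h hb
    rw [List.length_cons] at hR hb hRb
    rw [insertRow, IsChainList]
    refine ⟨hs.card_right.trans hL.1, ?_, ?_, ?_⟩
    · intro a ha
      rw [mem_union, mem_sdiff] at ha
      rcases ha with ha | ha
      · exact lt_of_lt_of_le (hRb a ha) (hw (by omega))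
      · exact hL.2.1 a ha.1
    · cases L with
      | nil =>
        intro B hB v
        simp only [insertRow, List.head?_cons, Option.mem_def, Option.some.injEq] at hB
        subst hB
        have h2 := hs.cnt_add v
        have h3 := hs.cnt_le v
        have h4 := cnt_subset hs.subset v
        omega
      | cons B L =>
        intro X hX v
        simp only [insertRow, List.head?_cons, Option.mem_def, Option.some.injEq] at hX
        subst hX
        have h2 := card_serve_of_card_passThrough h1.2
        exact hs.chain (swap_serve h2.1) (hL.2.2.1 B rfl) v
    · refine ih hL.2.2.2 ?_ h1.2 ?_
      · rw [h1.1, hR]; congr 1; omega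
      · rw [show i + 1 + L.length = i + (L.length + 1) by omega]; exact hb

lemma insertRow_injective {L L' : List (Finset ℕ)} {R R' : Finset ℕ}
    (h : #(passThrough L R) = #R) (h' : #(passThrough L' R') = #R')
    (he : insertRow R L = insertRow R' L') : R = R' ∧ L = L' := by
  induction L generalizing L' R R' with
  | nil =>
    cases L' with
    | nil => simpa [insertRow] using he
    | cons A' L' =>
      have := congrArg List.length he
      simp at this
  | cons A L ih =>
    cases L' with
    | nil =>
      have := congrArg List.length he
      simp at this
    | cons A' L' =>
      have h1 := card_serve_of_card_passThrough h
      have h1' := card_serve_of_card_passThrough h'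
      simp only [insertRow, List.cons.injEq] at he
      obtain ⟨h2, h3⟩ := ih h1.2 h1'.2 he.2
      have hs := swap_serve h1.1
      have hs' := swap_serve h1'.1
      rw [← he.1, ← h2] at hs'
      obtain ⟨h4, h5⟩ := hs.left_unique hs'
      exact ⟨h5, by rw [h4, h3]⟩

/-- The exchanges are undone from the end of the list to its head. The last conjunct, that the
extracted row is contained in the head, combines with dominance of the heads to provide the
hypothesis of `exists_swap_of_cnt_le` for the next exchange. -/
lemma exists_insertRow_eq (hw : Antitone w) {L' : List (Finset ℕ)} {i : ℕ} (hne : L' ≠ [])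
    (hL' : IsChainList ℓ w i L') :
    ∃ L R, L.length + 1 = L'.length ∧ IsChainList ℓ w i L ∧ #R = ℓ (i + L.length) ∧
      #(passThrough L R) = #R ∧ (∀ a ∈ passThrough L R, a < w (i + L.length)) ∧
      insertRow R L = L' ∧ ∀ N ∈ L'.head?, R ⊆ N := by
  induction L' generalizing i with
  | nil => exact absurd rfl hne
  | cons N L' ih =>
    cases L' with
    | nil =>
      refine ⟨[], N, rfl, trivial, ?_, rfl, ?_, rfl, ?_⟩
      · simpa [IsChainList] using hL'.1
      · simpa [IsChainList, passThrough] using hL'.2.1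
      · simp
    | cons N' L'' =>
      obtain ⟨L, M, h1, h2, h3, h4, h5, h6, h7⟩ := ih (by simp) hL'.2.2.2
      have hMN : ∀ v, cnt M v ≤ cnt N v := fun v =>
        (cnt_subset (h7 N' rfl) v).trans (hL'.2.2.1 N' rfl v)
      obtain ⟨A, R, hs⟩ := exists_swap_of_cnt_le hMN
      have hR : serve A R = M := hs.serve_eq
      have hMb := bounded_of_passThrough h4 h5
      rw [show i + 1 + L.length = i + (L.length + 1) by omega] at h3 h5 hMb
      refine ⟨A :: L, R, by simp [← h1], ⟨hs.card_right.symm.trans hL'.1, ?_, ?_, h2⟩, ?_, ?_,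
        ?_, ?_, ?_⟩
      · intro a ha
        rw [hs.left_eq, mem_union, mem_sdiff] at ha
        rcases ha with ha | ha
        · exact lt_of_lt_of_le (hMb a ha) (hw (by omega))
        · exact hL'.2.1 a ha.1
      · intro B hB v
        cases L with
        | nil => simp at hB
        | cons B' L =>
          simp only [List.head?_cons, Option.mem_def, Option.some.injEq] at hB
          subst hB
          have h8 := card_serve_of_card_passThrough h4
          have hs' := swap_serve h8.1
          simp only [insertRow, List.cons.injEq] at h6
          rw [h6.1] at hs'
          exact hs.chain_symm hs' (hL'.2.2.1 N' rfl) v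
      · rw [← hs.card_eq, h3, List.length_cons]
      · rw [passThrough, hR, h4, hs.card_eq]
      · rw [passThrough, hR, List.length_cons]; exact h5
      · rw [insertRow, hR, h6, ← hs.eq_union]
      · intro X hX
        simp only [List.head?_cons, Option.mem_def, Option.some.injEq] at hX
        subst hX
        exact hs.subset_right

lemma isChainList_rectify (hw : Antitone w) {L : List (Finset ℕ)} (hL : IsQueueList ℓ w L) :
    IsChainList ℓ w 0 (rectify L) := by
  induction L with
  | nil => trivial
  | cons R L ih =>
    obtain ⟨h1, h2, h3, h4⟩ := hL
    refine isChainList_insertRow hw (ih h1) ?_ ?_ ?_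
    · rw [length_rectify, zero_add, h2]
    · rw [passThrough_rectify, h3]
    · rw [passThrough_rectify, length_rectify, zero_add]; exact h4

lemma rectify_injOn {L L' : List (Finset ℕ)} (hL : IsQueueList ℓ w L) (hL' : IsQueueList ℓ w L')
    (he : rectify L = rectify L') : L = L' := by
  induction L generalizing L' with
  | nil =>
    have := congrArg List.length he
    simp only [length_rectify, List.length_nil] at this
    exact (List.length_eq_zero_iff.1 this.symm).symm
  | cons R L ih =>
    cases L' with
    | nil => have := congrArg List.length he; simp at this
    | cons R' L' =>
      obtain ⟨h1, -, h3, -⟩ := hL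
      obtain ⟨h1', -, h3', -⟩ := hL'
      obtain ⟨h4, h5⟩ := insertRow_injective (by rw [passThrough_rectify, h3])
        (by rw [passThrough_rectify, h3']) he
      rw [h4, ih h1 h1' h5]

lemma exists_rectify_eq (hw : Antitone w) {L' : List (Finset ℕ)} (hL' : IsChainList ℓ w 0 L') :
    ∃ L, IsQueueList ℓ w L ∧ rectify L = L' := by
  induction hn : L'.length generalizing L' with
  | zero => exact ⟨[], trivial, (List.length_eq_zero_iff.1 hn).symm⟩
  | succ m ih =>
    obtain ⟨L₁, R, h1, h2, h3, h4, h5, h6, -⟩ :=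
      exists_insertRow_eq hw (by rintro rfl; simp at hn) hL'
    obtain ⟨L, h7, h8⟩ := ih h2 (by omega)
    have hlen : L.length = L₁.length := by rw [← h8, length_rectify]
    refine ⟨R :: L, ⟨h7, ?_, ?_, ?_⟩, ?_⟩
    · rw [h3, zero_add, hlen]
    · rw [← passThrough_rectify, h8, h4]
    · rw [← passThrough_rectify, h8, hlen]; simpa using h5
    · rw [rectify, h8, h6]

/-- The product of the weights of all elements of all rows of a list. -/
def listWeight {K : Type*} [CommMonoid K] (y : ℕ → K) (L : List (Finset ℕ)) : K :=
  (L.map fun A => ∏ a ∈ A, y a).prod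

lemma listWeight_insertRow {K : Type*} [CommMonoid K] (y : ℕ → K) {L : List (Finset ℕ)}
    {R : Finset ℕ} (h : #(passThrough L R) = #R) :
    listWeight y (insertRow R L) = (∏ a ∈ R, y a) * listWeight y L := by
  induction L generalizing R with
  | nil => rfl
  | cons A L ih =>
    have h1 := card_serve_of_card_passThrough h
    have h2 := ih h1.2
    simp only [listWeight, List.map_cons, List.prod_cons, insertRow] at h2 ⊢
    rw [h2, ← mul_assoc, (swap_serve h1.1).prod_mul, mul_assoc]

lemma listWeight_rectify {K : Type*} [CommMonoid K] (y : ℕ → K) {L : List (Finset ℕ)}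
    (hL : IsQueueList ℓ w L) : listWeight y (rectify L) = listWeight y L := by
  induction L with
  | nil => rfl
  | cons R L ih =>
    obtain ⟨h1, -, h3, -⟩ := hL
    rw [rectify, listWeight_insertRow y (by rw [passThrough_rectify, h3]), ih h1]
    simp [listWeight]

end Rows

/-! ### The flagged dual Jacobi–Trudi formula. -/

section Determinant

variable {K : Type*} [CommRing K] (y : ℕ → K)

/-- The elementary symmetric polynomial of degree `m` in `y 0, …, y (v - 1)`. -/
def elemSymm (v : ℕ) (m : ℤ) : K :=
  if 0 ≤ m then ∑ A ∈ powersetCard m.toNat (range v), ∏ a ∈ A, y a else 0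

lemma elemSymm_of_neg {v : ℕ} {m : ℤ} (h : m < 0) : elemSymm y v m = 0 := if_neg (by omega)

lemma elemSymm_natCast (v m : ℕ) :
    elemSymm y v m = ∑ A ∈ powersetCard m (range v), ∏ a ∈ A, y a := by
  simp [elemSymm]

lemma elemSymm_succ (v : ℕ) (m : ℤ) :
    elemSymm y (v + 1) m = elemSymm y v m + y v * elemSymm y v (m - 1) := by
  rcases lt_or_ge m 0 with h | h
  · simp [elemSymm_of_neg y h, elemSymm_of_neg y (show m - 1 < 0 by omega)]
  lift m to ℕ using h
  cases m with
  | zero =>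
    rw [elemSymm_of_neg y (show ((0 : ℕ) : ℤ) - 1 < 0 by simp), elemSymm_natCast, elemSymm_natCast]
    simp
  | succ m =>
    rw [show ((m + 1 : ℕ) : ℤ) - 1 = (m : ℕ) by push_cast; ring, elemSymm_natCast,
      elemSymm_natCast, elemSymm_natCast, range_add_one,
      powersetCard_succ_insert notMem_range_self, sum_union, sum_image, mul_sum]
    · congr 1
      refine sum_congr rfl fun A hA => prod_insert fun h => ?_
      exact notMem_range_self ((mem_powersetCard.1 hA).1 h)
    · intro A hA B hB he
      have hA' : v ∉ A := fun h => notMem_range_self ((mem_powersetCard.1 hA).1 h)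
      have hB' : v ∉ B := fun h => notMem_range_self ((mem_powersetCard.1 hB).1 h)
      rw [← erase_insert hA', ← erase_insert hB', he]
    · rw [disjoint_left]
      intro A hA hB
      obtain ⟨B, -, rfl⟩ := mem_image.1 hB
      exact notMem_range_self ((mem_powersetCard.1 hA).1 (mem_insert_self _ _))

lemma elemSymm_zero (m : ℤ) : elemSymm y 0 m = if m = 0 then 1 else 0 := by
  rcases lt_or_ge m 0 with h | h
  · rw [elemSymm_of_neg y h, if_neg (by omega)]
  lift m to ℕ using h
  rw [elemSymm_natCast]
  cases m with
  | zero => simp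
  | succ m =>
    rw [powersetCard_eq_empty.2 (by simp), sum_empty, if_neg (by omega)]

variable {h : ℕ}

open Classical in
/-- Chains of finite sets of sizes `μ`, bounded by `w`, each dominating the preceding one. -/
noncomputable def chainSet (μ : Fin h → ℤ) (w : Fin h → ℕ) : Finset (Fin h → Finset ℕ) :=
  {A ∈ Fintype.piFinset fun i => (range (w i)).powerset | (∀ i, (#(A i) : ℤ) = μ i) ∧
    ∀ i j : Fin h, (i : ℕ) + 1 = j → ∀ v, cnt (A j) v ≤ cnt (A i) v}

lemma mem_chainSet {μ : Fin h → ℤ} {w : Fin h → ℕ} {A : Fin h → Finset ℕ} :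
    A ∈ chainSet μ w ↔ (∀ i, ∀ a ∈ A i, a < w i) ∧ (∀ i, (#(A i) : ℤ) = μ i) ∧
      ∀ i j : Fin h, (i : ℕ) + 1 = j → ∀ v, cnt (A j) v ≤ cnt (A i) v := by
  simp [chainSet, subset_iff]

/-- The generating function of `chainSet μ w`. -/
noncomputable def chainSum (μ : Fin h → ℤ) (w : Fin h → ℕ) : K :=
  ∑ A ∈ chainSet μ w, ∏ i, ∏ a ∈ A i, y a

/-- The matrix of the flagged dual Jacobi–Trudi formula. -/
def flaggedMatrix (μ : Fin h → ℤ) (w : Fin h → ℕ) : Matrix (Fin h) (Fin h) K :=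
  fun i j => elemSymm y (w i) (μ i - i + j)

lemma chainSet_eq_empty {μ : Fin h → ℤ} {w : Fin h → ℕ} {i j : Fin h} (hij : (i : ℕ) + 1 = j)
    (hμ : μ i < μ j) : chainSet μ w = ∅ := by
  rw [eq_empty_iff_forall_notMem]
  intro A hA
  obtain ⟨h1, h2, h3⟩ := mem_chainSet.1 hA
  have h4 := h3 i j hij (w j)
  rw [(cnt_eq_card_iff _ _).2 (h1 j)] at h4
  have h5 := cnt_le_card (A i) (w j)
  have h6 := h2 i
  have h7 := h2 j
  omega

/-- Rows `i` and `j` coincide. This is the determinantal counterpart of `chainSet_eq_empty`. -/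
lemma det_flaggedMatrix_eq_zero {μ : Fin h → ℤ} {w : Fin h → ℕ} {i j : Fin h}
    (hij : (i : ℕ) + 1 = j) (hμ : μ j = μ i + 1) (hw : w i = w j) :
    (flaggedMatrix y μ w).det = 0 := by
  refine Matrix.det_zero_of_row_eq (i := i) (j := j) (by rintro rfl; omega) ?_
  funext c
  rw [flaggedMatrix, hw]
  congr 1
  omega

lemma le_of_succ_le {μ : Fin h → ℤ} (hμ : ∀ i j : Fin h, (i : ℕ) + 1 = j → μ j ≤ μ i)
    {i j : Fin h} (hij : i ≤ j) : μ j ≤ μ i := by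
  have key : ∀ k, ∀ i j : Fin h, (i : ℕ) + k = j → μ j ≤ μ i := by
    intro k
    induction k with
    | zero => intro i j hij; rw [show i = j from Fin.ext (by omega)]
    | succ k ih =>
      intro i j hij
      exact (ih ⟨i + 1, by omega⟩ j (by simp; omega)).trans (hμ i ⟨i + 1, by omega⟩ rfl)
  exact key (j - i) i j (by have : (i : ℕ) ≤ j := hij; omega)

/-- Without variables the matrix is the identity when `μ = 0`. Otherwise a negative part makes the
last row vanish, or a positive part the first row, and there are no chains. -/
lemma det_flaggedMatrix_zero {μ : Fin h → ℤ}
    (hμ : ∀ i j : Fin h, (i : ℕ) + 1 = j → μ j ≤ μ i) :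
    (flaggedMatrix y μ fun _ => 0).det = chainSum y μ fun _ => 0 := by
  by_cases h0 : μ = 0
  · subst h0
    have h1 : flaggedMatrix y (0 : Fin h → ℤ) (fun _ => 0) = 1 := by
      ext i j
      rw [flaggedMatrix, elemSymm_zero, Matrix.one_apply]
      congr 1
      rw [Fin.ext_iff]
      simp
      omega
    have h2 : chainSet (0 : Fin h → ℤ) (fun _ => 0) = {fun _ => ∅} := by
      ext A
      rw [mem_chainSet, mem_singleton]
      constructor
      · rintro ⟨h3, -⟩
        funext i
        rw [eq_empty_iff_forall_notMem]
        exact fun a ha => absurd (h3 i a ha) (by simp)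
      · rintro rfl
        simp
    rw [h1, Matrix.det_one, chainSum, h2]
    simp
  · obtain ⟨i, hi⟩ := Function.ne_iff.1 h0
    have h2 : chainSet μ (fun _ => 0) = ∅ := by
      rw [eq_empty_iff_forall_notMem]
      intro A hA
      obtain ⟨h3, h4, -⟩ := mem_chainSet.1 hA
      have : A i = ∅ := by
        rw [eq_empty_iff_forall_notMem]
        exact fun a ha => absurd (h3 i a ha) (by simp)
      have h5 := h4 i
      rw [this] at h5
      simp at h5 hi
      exact hi h5.symm
    rw [chainSum, h2, sum_empty]
    have hh : 0 < h := i.pos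
    rcases lt_or_gt_of_ne hi with hi | hi
    · refine Matrix.det_eq_zero_of_row_eq_zero ⟨h - 1, by omega⟩ fun j => ?_
      apply elemSymm_of_neg
      have := le_of_succ_le hμ (show i ≤ ⟨h - 1, by omega⟩ from by
        rw [Fin.le_def]; simp; omega)
      simp at hi
      simp only
      omega
    · refine Matrix.det_eq_zero_of_row_eq_zero ⟨0, hh⟩ fun j => ?_
      rw [flaggedMatrix, elemSymm_zero, if_neg]
      have := le_of_succ_le hμ (show ⟨0, hh⟩ ≤ i from by rw [Fin.le_def]; simp)
      simp at hi
      simp only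
      omega

/-- Each row splits by the recursion for elementary symmetric polynomials in the last variable. By
multilinearity the determinant is a sum over the set `T` of rows that contribute the term with `y
v`. -/
lemma det_flaggedMatrix_succ (μ : Fin h → ℤ) (w : Fin h → ℕ) (v : ℕ) :
    (flaggedMatrix y μ fun i => min (w i) (v + 1)).det =
      ∑ T : Finset (Fin h), (∏ i ∈ T, if v < w i then y v else 0) *
        (flaggedMatrix y (fun i => μ i - if i ∈ T then 1 else 0) fun i => min (w i) v).det := by
  have h1 : (flaggedMatrix y μ fun i => min (w i) (v + 1)) =
      (Matrix.of fun (i j : Fin h) => (if v < w i then y v else 0) *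
        elemSymm y (min (w i) v) (μ i - 1 - i + j)) + flaggedMatrix y μ fun i => min (w i) v := by
    funext i j
    simp only [flaggedMatrix, Matrix.add_apply, Matrix.of_apply]
    split_ifs with hv
    · rw [min_eq_right (by omega), min_eq_right (by omega), elemSymm_succ, add_comm]
      congr 3
      ring
    · rw [min_eq_left (by omega), min_eq_left (by omega), zero_mul, zero_add]
  have hadd : ∀ M N : Matrix (Fin h) (Fin h) K, (M + N).det =
      ∑ T : Finset (Fin h), Matrix.det (T.piecewise M N) := fun M N =>
    (Matrix.detRowAlternating (R := K) (n := Fin h)).toMultilinearMap.map_add_univ M N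
  rw [h1, hadd]
  refine sum_congr rfl fun T _ => ?_
  have h2 : ∏ i ∈ T, (if v < w i then y v else 0) =
      ∏ i, if i ∈ T then if v < w i then y v else 0 else 1 := by
    rw [prod_ite_mem, univ_inter]
  rw [h2, ← Matrix.det_mul_column]
  congr 1
  ext i j
  have h3 : ∀ M N : Matrix (Fin h) (Fin h) K,
      T.piecewise M N i j = if i ∈ T then M i j else N i j := fun M N => by
    unfold piecewise; split_ifs <;> rfl
  rw [h3]
  by_cases hi : i ∈ T <;> simp [hi, flaggedMatrix]

lemma cnt_congr_of_le {A B : Finset ℕ} {v : ℕ} (h : ∀ a < v, a ∈ A ↔ a ∈ B) {u : ℕ}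
    (hu : u ≤ v) : cnt A u = cnt B u := by
  unfold cnt
  congr 1
  ext a
  simp only [mem_filter]
  constructor
  · rintro ⟨h1, h2⟩; exact ⟨(h a (by omega)).1 h1, h2⟩
  · rintro ⟨h1, h2⟩; exact ⟨(h a (by omega)).2 h1, h2⟩

lemma erase_mem_chainSet {μ : Fin h → ℤ} {w : Fin h → ℕ} {v : ℕ} {A : Fin h → Finset ℕ}
    (hA : A ∈ chainSet μ fun i => min (w i) (v + 1)) :
    (fun i => (A i).erase v) ∈ chainSet (fun i => μ i - if v ∈ A i then 1 else 0)
      fun i => min (w i) v := by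
  obtain ⟨h1, h2, h3⟩ := mem_chainSet.1 hA
  have hc : ∀ i u, u ≤ v → cnt ((A i).erase v) u = cnt (A i) u := fun i u hu =>
    cnt_congr_of_le (fun a ha => by simp [ha.ne]) hu
  have hb : ∀ i, ∀ a ∈ (A i).erase v, a < v := by
    intro i a ha
    have := h1 i a (mem_of_mem_erase ha)
    have := ne_of_mem_erase ha
    omega
  refine mem_chainSet.2 ⟨?_, ?_, ?_⟩
  · intro i a ha
    have := h1 i a (mem_of_mem_erase ha)
    have := hb i a ha
    omega
  · intro i
    split_ifs with hv
    · rw [card_erase_of_mem hv, ← h2, Nat.cast_sub (card_pos.2 ⟨v, hv⟩), Nat.cast_one]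
    · rw [erase_eq_of_notMem hv, h2, sub_zero]
  · intro i j hij u
    rcases le_or_gt u v with hu | hu
    · rw [hc i u hu, hc j u hu]; exact h3 i j hij u
    · have e : ∀ i, cnt ((A i).erase v) u = cnt (A i) v := fun i => by
        rw [← hc i v le_rfl, (cnt_eq_card_iff _ v).2 (hb i),
          (cnt_eq_card_iff _ u).2 fun a ha => (hb i a ha).trans hu]
      rw [e, e]; exact h3 i j hij v

/-- Only counts beyond `v` see the new element, and there they are the full sizes `μ i`; weak
decrease of `μ` is then exactly dominance. -/
lemma insert_mem_chainSet {μ : Fin h → ℤ} (hμ : ∀ i j : Fin h, (i : ℕ) + 1 = j → μ j ≤ μ i)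
    {w : Fin h → ℕ} {v : ℕ} {T : Finset (Fin h)} (hT : ∀ i ∈ T, v < w i)
    {A : Fin h → Finset ℕ}
    (hA : A ∈ chainSet (fun i => μ i - if i ∈ T then 1 else 0) fun i => min (w i) v) :
    (fun i => if i ∈ T then insert v (A i) else A i) ∈
      chainSet μ fun i => min (w i) (v + 1) := by
  obtain ⟨h1, h2, h3⟩ := mem_chainSet.1 hA
  have hv : ∀ i, v ∉ A i := fun i hi => by have := h1 i v hi; omega
  set A' : Fin h → Finset ℕ := fun i => if i ∈ T then insert v (A i) else A i with hA'
  have hb : ∀ i, ∀ a ∈ A' i, a < min (w i) (v + 1) := by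
    intro i a ha
    simp only [hA'] at ha
    split_ifs at ha with hi
    · rcases mem_insert.1 ha with rfl | ha
      · have := hT i hi; omega
      · have := h1 i a ha; omega
    · have := h1 i a ha; omega
  have hcard : ∀ i, (#(A' i) : ℤ) = μ i := by
    intro i
    have := h2 i
    simp only [hA']
    split_ifs with hi
    · rw [card_insert_of_notMem (hv i)]; simp only [hi, if_true] at this; push_cast; omega
    · simp only [hi, if_false] at this; omega
  refine mem_chainSet.2 ⟨hb, hcard, fun i j hij u => ?_⟩
  rcases le_or_gt u v with hu | hu
  · have hc : ∀ i, cnt (A' i) u = cnt (A i) u := fun i => by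
      refine cnt_congr_of_le (fun a ha => ?_) hu
      simp only [hA']
      split_ifs <;> simp [ha.ne]
    rw [hc, hc]; exact h3 i j hij u
  · have e : ∀ i, (cnt (A' i) u : ℤ) = μ i := fun i => by
      rw [(cnt_eq_card_iff _ u).2 fun a ha => by have := hb i a ha; omega, hcard]
    have := hμ i j hij
    rw [← e, ← e] at this
    exact_mod_cast this

lemma chainSum_succ {μ : Fin h → ℤ} (hμ : ∀ i j : Fin h, (i : ℕ) + 1 = j → μ j ≤ μ i)
    (w : Fin h → ℕ) (v : ℕ) :
    chainSum y μ (fun i => min (w i) (v + 1)) =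
      ∑ T : Finset (Fin h), (∏ i ∈ T, if v < w i then y v else 0) *
        chainSum y (fun i => μ i - if i ∈ T then 1 else 0) fun i => min (w i) v := by
  classical
  rw [chainSum, ← sum_fiberwise _ (fun A => ({i | v ∈ A i} : Finset (Fin h)))]
  refine sum_congr rfl fun T _ => ?_
  by_cases hT : ∀ i ∈ T, v < w i
  · have hv : ∀ A ∈ chainSet (fun i => μ i - if i ∈ T then 1 else 0) (fun i => min (w i) v),
        ∀ i, v ∉ A i := fun A hA i hi => by
      have := (mem_chainSet.1 hA).1 i v hi
      omega
    rw [chainSum, mul_sum]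
    refine sum_bij' (fun A _ i => (A i).erase v)
      (fun A _ i => if i ∈ T then insert v (A i) else A i) ?_ ?_ ?_ ?_ ?_
    · intro A hA
      obtain ⟨hA, hAT⟩ := mem_filter.1 hA
      have := erase_mem_chainSet hA
      simp only [← hAT, mem_filter, mem_univ, true_and]
      exact this
    · intro A hA
      refine mem_filter.2 ⟨insert_mem_chainSet hμ hT hA, ?_⟩
      ext i
      simp only [mem_filter, mem_univ, true_and]
      split_ifs with hi <;> simp [hi, hv A hA]
    · intro A hA
      obtain ⟨-, hAT⟩ := mem_filter.1 hA
      funext i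
      simp only [← hAT, mem_filter, mem_univ, true_and]
      split_ifs with hi
      · exact insert_erase hi
      · exact erase_eq_of_notMem hi
    · intro A hA
      funext i
      dsimp only
      split_ifs
      · exact erase_insert (hv A hA i)
      · exact erase_eq_of_notMem (hv A hA i)
    · intro A hA
      obtain ⟨-, hAT⟩ := mem_filter.1 hA
      rw [prod_congr rfl fun i hi => if_pos (hT i hi), ← hAT, prod_filter, ← prod_mul_distrib]
      refine prod_congr rfl fun i _ => ?_
      split_ifs with hi
      · exact (mul_prod_erase _ _ hi).symm
      · dsimp only
        rw [one_mul, erase_eq_of_notMem hi]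
  · push Not at hT
    obtain ⟨i, hi, hvi⟩ := hT
    rw [prod_eq_zero hi (if_neg (by omega)), zero_mul]
    refine sum_eq_zero fun A hA => ?_
    obtain ⟨hA, hAT⟩ := mem_filter.1 hA
    rw [← hAT] at hi
    have h1 := (mem_chainSet.1 hA).1 i v (mem_filter.1 hi).2
    omega

/-- The flagged dual Jacobi–Trudi formula. -/
theorem det_flaggedMatrix (μ : Fin h → ℤ) {w : Fin h → ℕ} (hw : Antitone w)
    (hμ : ∀ i j : Fin h, (i : ℕ) + 1 = j → (w i : ℤ) - w j ≤ μ i - μ j + 1) :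
    (flaggedMatrix y μ w).det = chainSum y μ w := by
  have key : ∀ v, ∀ μ : Fin h → ℤ, (∀ i j : Fin h, (i : ℕ) + 1 = j →
      ((min (w i) v : ℕ) : ℤ) - (min (w j) v : ℕ) ≤ μ i - μ j + 1) →
      (flaggedMatrix y μ fun i => min (w i) v).det = chainSum y μ fun i => min (w i) v := by
    intro v
    induction v with
    | zero =>
      intro μ hμ
      simp only [Nat.min_zero] at hμ ⊢
      by_cases hp : ∀ i j : Fin h, (i : ℕ) + 1 = j → μ j ≤ μ i
      · exact det_flaggedMatrix_zero y hp
      · push Not at hp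
        obtain ⟨i, j, hij, h1⟩ := hp
        have h2 := hμ i j hij
        rw [det_flaggedMatrix_eq_zero y hij (by omega) rfl, chainSum, chainSet_eq_empty hij h1,
          sum_empty]
    | succ v ih =>
      intro μ hμ
      by_cases hp : ∀ i j : Fin h, (i : ℕ) + 1 = j → μ j ≤ μ i
      · rw [det_flaggedMatrix_succ, chainSum_succ y hp]
        refine sum_congr rfl fun T _ => ?_
        by_cases hT : ∀ i ∈ T, v < w i
        swap
        · push Not at hT
          obtain ⟨i, hi, hvi⟩ := hT
          rw [prod_eq_zero hi (if_neg (by omega)), zero_mul, zero_mul]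
        rw [ih]
        intro i j hij
        have hTi := hT i
        have h1 := hμ i j hij
        have h2 := hp i j hij
        have h3 : w j ≤ w i := hw (by rw [Fin.le_def]; omega)
        by_cases hi : i ∈ T <;> by_cases hj : j ∈ T <;>
          simp only [hi, hj, if_true, if_false, forall_true_left] at hTi ⊢ <;> omega
      · push Not at hp
        obtain ⟨i, j, hij, h1⟩ := hp
        have h2 := hμ i j hij
        have h3 : w j ≤ w i := hw (by rw [Fin.le_def]; omega)
        -- The hypothesis on `μ` and `w`, with `w` antitone, leaves only `μ j = μ i + 1` and equal
        -- truncated bounds, so both sides vanish.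
        rw [det_flaggedMatrix_eq_zero y hij (by omega) (by omega), chainSum,
          chainSet_eq_empty hij h1, sum_empty]
  obtain ⟨v, hv⟩ : ∃ v, ∀ i, w i ≤ v := ⟨∑ i, w i, fun i => single_le_sum (by simp) (mem_univ i)⟩
  have h1 : (fun i => min (w i) v) = w := funext fun i => min_eq_left (hv i)
  have h2 := key v μ
  rw [h1] at h2
  refine h2 fun i j hij => ?_
  rw [min_eq_left (hv i), min_eq_left (hv j)]
  exact hμ i j hij

end Determinant

/-! ### Row lists, and the elements of a row used by higher rows. -/

section Levels

/-- The rows `ρ (m - 1), …, ρ 0`, the top row first. -/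
def rowList (ρ : ℕ → Finset ℕ) : ℕ → List (Finset ℕ)
  | 0 => []
  | m + 1 => ρ m :: rowList ρ m

@[simp] lemma length_rowList (ρ : ℕ → Finset ℕ) (m : ℕ) : (rowList ρ m).length = m := by
  induction m with
  | zero => rfl
  | succ m ih => simp [rowList, ih]

lemma rowList_congr {ρ ρ' : ℕ → Finset ℕ} {m : ℕ} (h : ∀ r < m, ρ r = ρ' r) :
    rowList ρ m = rowList ρ' m := by
  induction m with
  | zero => rfl
  | succ m ih => rw [rowList, rowList, h m (by omega), ih fun r hr => h r (by omega)]

lemma eq_of_rowList_eq {ρ ρ' : ℕ → Finset ℕ} {m : ℕ} (h : rowList ρ m = rowList ρ' m) :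
    ∀ r < m, ρ r = ρ' r := by
  induction m with
  | zero => intro r hr; omega
  | succ m ih =>
    simp only [rowList, List.cons.injEq] at h
    intro r hr
    rcases Nat.lt_succ_iff_lt_or_eq.1 hr with hr | rfl
    · exact ih h.2 r hr
    · exact h.1

lemma exists_rowList_eq (L : List (Finset ℕ)) :
    ∃ ρ : ℕ → Finset ℕ, rowList ρ L.length = L ∧ ∀ m, L.length ≤ m → ρ m = ∅ := by
  induction L with
  | nil => exact ⟨fun _ => ∅, rfl, fun _ _ => rfl⟩
  | cons R L ih =>
    obtain ⟨ρ, h1, h2⟩ := ih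
    refine ⟨Function.update ρ L.length R, ?_, fun m hm => ?_⟩
    · rw [List.length_cons, rowList, Function.update_self,
        rowList_congr (ρ' := ρ) fun r hr => Function.update_of_ne (by omega) _ _, h1]
    · rw [List.length_cons] at hm
      rw [Function.update_of_ne (by omega), h2 m (by omega)]

/-- The elements of row `r` that are used by the elements of row `r + j`. -/
def levelSet (ρ : ℕ → Finset ℕ) : ℕ → ℕ → Finset ℕ
  | r, 0 => ρ r
  | r, j + 1 => serve (ρ r) (levelSet ρ (r + 1) j)

lemma passThrough_rowList (ρ : ℕ → Finset ℕ) (m j : ℕ) :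
    passThrough (rowList ρ m) (levelSet ρ m j) = levelSet ρ 0 (m + j) := by
  induction m generalizing j with
  | zero => rw [rowList, passThrough, zero_add]
  | succ m ih =>
    rw [rowList, passThrough, show m + 1 + j = m + (j + 1) by omega, ← ih, levelSet]

lemma levelSet_succ_subset (ρ : ℕ → Finset ℕ) (r j : ℕ) :
    levelSet ρ r (j + 1) ⊆ levelSet ρ r j := by
  induction j generalizing r with
  | zero => exact serve_subset _ _
  | succ j ih => rw [levelSet, levelSet]; exact serve_mono _ (ih _)

lemma levelSet_subset (ρ : ℕ → Finset ℕ) (r : ℕ) {j j' : ℕ} (h : j ≤ j') :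
    levelSet ρ r j' ⊆ levelSet ρ r j :=
  antitone_nat_of_succ_le (f := levelSet ρ r) (levelSet_succ_subset ρ r) h

lemma card_levelSet_le (ρ : ℕ → Finset ℕ) (r j : ℕ) : #(levelSet ρ r j) ≤ #(ρ (r + j)) := by
  induction j generalizing r with
  | zero => rfl
  | succ j ih =>
    rw [levelSet, show r + (j + 1) = r + 1 + j by omega]
    exact (card_serve_le _ _).trans (ih _)

lemma card_levelSet_zero_le (ρ : ℕ → Finset ℕ) (r j : ℕ) :
    #(levelSet ρ 0 (r + j)) ≤ #(levelSet ρ r j) := by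
  induction r generalizing j with
  | zero => rw [zero_add]
  | succ r ih =>
    rw [show r + 1 + j = r + (j + 1) by omega]
    exact (ih _).trans (card_serve_le _ _)

variable {ℓ w : ℕ → ℕ}

lemma isQueueList_rowList {ρ : ℕ → Finset ℕ} {k : ℕ} : IsQueueList ℓ w (rowList ρ k) ↔
    ∀ m < k, #(ρ m) = ℓ m ∧ #(levelSet ρ 0 m) = ℓ m ∧ ∀ a ∈ levelSet ρ 0 m, a < w m := by
  induction k with
  | zero => simp [rowList, IsQueueList]
  | succ k ih =>
    have h := passThrough_rowList ρ k 0
    rw [add_zero] at h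
    change passThrough (rowList ρ k) (ρ k) = _ at h
    rw [rowList, IsQueueList, ih, h, length_rowList]
    constructor
    · rintro ⟨h1, h2, h3, h4⟩ m hm
      rcases Nat.lt_succ_iff_lt_or_eq.1 hm with hm | rfl
      · exact h1 m hm
      · exact ⟨h2, by rw [h3, h2], h4⟩
    · intro h1
      obtain ⟨h2, h3, h4⟩ := h1 k (by omega)
      exact ⟨fun m hm => h1 m (by omega), h2, by rw [h2, h3], h4⟩

lemma isChainList_iff {L : List (Finset ℕ)} {i : ℕ} : IsChainList ℓ w i L ↔
    (∀ j < L.length, #(L.getD j ∅) = ℓ (i + j) ∧ ∀ a ∈ L.getD j ∅, a < w (i + j)) ∧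
      ∀ j, j + 1 < L.length → ∀ v, cnt (L.getD (j + 1) ∅) v ≤ cnt (L.getD j ∅) v := by
  induction L generalizing i with
  | nil => simp [IsChainList]
  | cons A L ih =>
    rw [IsChainList, ih]
    constructor
    · rintro ⟨h1, h2, h3, h4, h5⟩
      refine ⟨fun j hj => ?_, fun j hj => ?_⟩
      · cases j with
        | zero => exact ⟨h1, h2⟩
        | succ j =>
          rw [show i + (j + 1) = i + 1 + j by omega]
          exact h4 j (by simpa using hj)
      · cases j with
        | zero =>
          cases L with
          | nil => simp at hj
          | cons B L => exact h3 B rfl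
        | succ j => exact h5 j (by simpa using hj)
    · rintro ⟨h1, h2⟩
      refine ⟨(h1 0 (by simp)).1, (h1 0 (by simp)).2, ?_, fun j hj => ?_, fun j hj => ?_⟩
      · cases L with
        | nil => simp
        | cons B L =>
          intro B' hB'
          simp only [List.head?_cons, Option.mem_def, Option.some.injEq] at hB'
          subst hB'
          exact h2 0 (by simp)
      · rw [show i + 1 + j = i + (j + 1) by omega]
        exact h1 (j + 1) (by simpa using hj)
      · exact h2 (j + 1) (by simpa using hj)

lemma isChainList_iff_mem_chainSet {L : List (Finset ℕ)} {k : ℕ} (hL : L.length = k) :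
    IsChainList ℓ w 0 L ↔ (fun i : Fin k => L.getD i ∅) ∈
      chainSet (fun i => (ℓ i : ℤ)) (fun i => w i) := by
  subst hL
  rw [isChainList_iff, mem_chainSet]
  constructor
  · rintro ⟨h1, h2⟩
    refine ⟨fun i => ?_, fun i => ?_, fun i j hij v => ?_⟩
    · have := (h1 i i.2).2
      rwa [zero_add] at this
    · have := (h1 i i.2).1
      rw [zero_add] at this
      exact_mod_cast this
    · have := h2 i (by omega) v
      rwa [hij] at this
  · rintro ⟨h1, h2, h3⟩
    refine ⟨fun j hj => ⟨?_, ?_⟩, fun j hj v => ?_⟩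
    · rw [zero_add]; exact_mod_cast h2 ⟨j, hj⟩
    · rw [zero_add]; exact h1 ⟨j, hj⟩
    · exact h3 ⟨j, by omega⟩ ⟨j + 1, hj⟩ rfl v

/-- The element of `A` that exceeds exactly `m` elements of `A`. -/
noncomputable def pick (A : Finset ℕ) (m : ℕ) : ℕ := Nat.nth (· ∈ A) m

lemma cnt_eq_count (A : Finset ℕ) (v : ℕ) : cnt A v = Nat.count (· ∈ A) v := by
  induction v with
  | zero => simp
  | succ v ih => rw [cnt_succ, Nat.count_succ, ih]

lemma pick_spec {A : Finset ℕ} {m : ℕ} (h : m < #A) : pick A m ∈ A ∧ cnt A (pick A m) = m := by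
  have hf : ∀ hf : {x | x ∈ A}.Finite, m < #hf.toFinset := by
    intro hf
    have : hf.toFinset = A := by ext; simp
    rwa [this]
  exact ⟨Nat.nth_mem m hf, by rw [cnt_eq_count]; exact Nat.count_nth hf⟩

lemma eq_of_cnt_eq {A : Finset ℕ} {a b : ℕ} (ha : a ∈ A) (hb : b ∈ A) (h : cnt A a = cnt A b) :
    a = b := by
  have key : ∀ {a b}, a ∈ A → a < b → cnt A a < cnt A b := by
    intro a b ha hab
    have h1 := cnt_mono A (show a + 1 ≤ b from hab)
    rw [cnt_succ, if_pos ha] at h1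
    omega
  rcases lt_trichotomy a b with h1 | h1 | h1
  · have := key ha h1; omega
  · exact h1
  · have := key hb h1; omega

lemma card_add_le {A : Finset ℕ} {b x : ℕ} (hA : ∀ a ∈ A, a < b) (hx : x ≤ b) :
    #A + x ≤ cnt A x + b := by
  have h1 : ∀ j, cnt A (x + j) ≤ cnt A x + j := by
    intro j
    induction j with
    | zero => simp
    | succ j ih => rw [← add_assoc, cnt_succ]; split_ifs <;> omega
  have h2 := h1 (b - x)
  rw [show x + (b - x) = b by omega, (cnt_eq_card_iff A b).2 hA] at h2
  omega

lemma cnt_image {ι : Type*} [DecidableEq ι] {s : Finset ι} {f : ι → ℕ} (hf : Set.InjOn f s)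
    (v : ℕ) : cnt (s.image f) v = #{i ∈ s | f i < v} := by
  unfold cnt
  rw [filter_image, card_image_of_injOn (hf.mono (coe_subset.2 (filter_subset _ _)))]

end Levels

/-! ### Heights, row lengths and basement entries of skip compositions. -/

section SkipComposition

variable {n : ℕ} (S : Finset (Fin n))

lemma skipComposition_of_mem {i : Fin n} (h : i ∈ S) :
    skipComposition S i + #{t ∈ S | t < i} = i + 1 := by
  have : #{t ∈ S | t < i} ≤ i := by
    calc #{t ∈ S | t < i} ≤ #(Iio i) := card_le_card fun t ht => by simpa using (mem_filter.1 ht).2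
      _ = i := Fin.card_Iio i
  rw [skipComposition, if_pos h]
  omega

lemma skipComposition_pos {i : Fin n} : 0 < skipComposition S i ↔ i ∈ S := by
  constructor
  · intro h
    by_contra hi
    rw [skipComposition, if_neg hi] at h
    omega
  · intro h
    have : #{t ∈ S | t < i} ≤ i := by
      calc #{t ∈ S | t < i} ≤ #(Iio i) :=
            card_le_card fun t ht => by simpa using (mem_filter.1 ht).2
        _ = i := Fin.card_Iio i
    rw [skipComposition, if_pos h]
    omega

lemma card_filter_lt_le {i j : Fin n} (hij : i ≤ j) :
    #{t ∈ S | t < j} + i ≤ #{t ∈ S | t < i} + j := by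
  have h1 : {t ∈ S | t < j} ⊆ {t ∈ S | t < i} ∪ Ico i j := by
    intro t
    simp only [mem_filter, mem_union, mem_Ico]
    rintro ⟨h1, h2⟩
    rcases lt_or_ge t i with h | h
    · exact Or.inl ⟨h1, h⟩
    · exact Or.inr ⟨h, h2⟩
  have h2 := (card_le_card h1).trans (card_union_le _ _)
  rw [Fin.card_Ico] at h2
  have : (i : ℕ) ≤ j := hij
  omega

lemma skipComposition_mono {i j : Fin n} (hi : 0 < skipComposition S i)
    (hj : 0 < skipComposition S j) (hij : i ≤ j) : skipComposition S i ≤ skipComposition S j := by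
  rw [skipComposition_pos] at hi hj
  have h1 := skipComposition_of_mem S hi
  have h2 := skipComposition_of_mem S hj
  have h3 := card_filter_lt_le S hij
  omega

lemma skipComposition_le {k : ℕ} (hkn : k ≤ n) (hS : #S = n - k + 1) (i : Fin n) :
    skipComposition S i ≤ k := by
  by_cases hi : i ∈ S
  · have h1 := skipComposition_of_mem S hi
    have h2 : S ⊆ {t ∈ S | t < i} ∪ Ici i := by
      intro t ht
      simp only [mem_filter, mem_union, mem_Ici]
      rcases lt_or_ge t i with h | h
      · exact Or.inl ⟨ht, h⟩
      · exact Or.inr h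
    have h3 := (card_le_card h2).trans (card_union_le _ _)
    rw [Fin.card_Ici] at h3
    omega
  · rw [skipComposition, if_neg hi]; exact Nat.zero_le _

/-- The number of cells of the skyline diagram of `γ` in row `r + 1`. -/
def rowLength (γ : Fin n → ℕ) (r : ℕ) : ℕ := #{i | r < γ i}

/-- The strict upper bound for the entries in the first row of columns of height more than `r`. -/
def rowBound (k : ℕ) (γ : Fin n → ℕ) (r : ℕ) : ℕ := k - 1 - r + rowLength γ r

lemma rowLength_antitone (γ : Fin n → ℕ) : Antitone (rowLength γ) := fun a b hab =>
  card_le_card fun i => by simp only [mem_filter, mem_univ, true_and]; omega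

lemma rowBound_antitone (k : ℕ) (γ : Fin n → ℕ) : Antitone (rowBound k γ) := fun a b hab => by
  have := rowLength_antitone γ hab
  unfold rowBound
  omega

lemma rowLength_skipComposition_zero : rowLength (skipComposition S) 0 = #S := by
  unfold rowLength
  congr 1
  ext i
  simp [skipComposition_pos]

lemma rowLength_succ (γ : Fin n → ℕ) (r : ℕ) :
    rowLength γ r = rowLength γ (r + 1) + #{i | γ i = r + 1} := by
  unfold rowLength
  rw [← card_union_of_disjoint]
  · congr 1
    ext i
    simp only [mem_filter, mem_univ, true_and, mem_union]
    omega
  · rw [disjoint_left]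
    intro i
    simp only [mem_filter, mem_univ, true_and]
    omega

/-- Indices of equal nonzero parts of a skip composition are consecutive, so the basement entries
below the columns of height `g + 1` are the integers immediately below `rowBound k (skipComposition
S) g`. This turns the basement condition into a flag bound. -/
lemma basement_eq {k : ℕ} (hkn : k ≤ n) (hS : #S = n - k + 1) {i : Fin n} {g : ℕ}
    (hi : skipComposition S i = g + 1) :
    n - 1 - i + #{j | skipComposition S j = g + 1} =
      rowBound k (skipComposition S) g + #{j | skipComposition S j = g + 1 ∧ i < j} := by
  have hiS : i ∈ S := by rw [← skipComposition_pos, hi]; omega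
  have hgk := skipComposition_le S hkn hS i
  have h1 := skipComposition_of_mem S hiS
  have hn := i.2
  have h2 : #{j | skipComposition S j = g + 1} = #{j | skipComposition S j = g + 1 ∧ i < j} +
      #{j | skipComposition S j = g + 1 ∧ j ≤ i} := by
    rw [← card_union_of_disjoint]
    · congr 1
      ext j
      simp only [mem_filter, mem_univ, true_and, mem_union, ← and_or_left, lt_or_ge i j, and_true]
    · rw [disjoint_left]
      intro j
      simp only [mem_filter, mem_univ, true_and]
      rintro ⟨-, h3⟩ ⟨-, h4⟩
      exact absurd h3 (not_lt.2 h4)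
  have h3 : {t ∈ S | t < i} ∪ ({j | g < skipComposition S j} : Finset (Fin n)) = S := by
    ext j
    simp only [mem_filter, mem_univ, true_and, mem_union]
    constructor
    · rintro (h | h)
      · exact h.1
      · rw [← skipComposition_pos]; omega
    · intro hj
      rcases lt_or_ge j i with h | h
      · exact Or.inl ⟨hj, h⟩
      · have := skipComposition_mono S ((skipComposition_pos S).2 hiS)
          ((skipComposition_pos S).2 hj) h
        exact Or.inr (by omega)
  have h4 : {t ∈ S | t < i} ∩ ({j | g < skipComposition S j} : Finset (Fin n)) =
      ({j | skipComposition S j = g + 1 ∧ j < i} : Finset (Fin n)) := by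
    ext j
    simp only [mem_filter, mem_univ, true_and, mem_inter]
    constructor
    · rintro ⟨⟨h5, h6⟩, h7⟩
      have := skipComposition_mono S ((skipComposition_pos S).2 h5)
        ((skipComposition_pos S).2 hiS) h6.le
      exact ⟨by omega, h6⟩
    · rintro ⟨h5, h6⟩
      exact ⟨⟨by rw [← skipComposition_pos]; omega, h6⟩, by omega⟩
  have h5 := card_union_add_card_inter {t ∈ S | t < i}
    ({j | g < skipComposition S j} : Finset (Fin n))
  rw [h3, h4] at h5
  have h6 : #{j | skipComposition S j = g + 1 ∧ j ≤ i} =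
      #{j | skipComposition S j = g + 1 ∧ j < i} + 1 := by
    rw [← card_insert_of_notMem (a := i) (by simp)]
    congr 1
    ext j
    simp only [mem_filter, mem_univ, true_and, mem_insert, le_iff_lt_or_eq]
    constructor
    · rintro ⟨h7, h8 | h8⟩
      · exact Or.inr ⟨h7, h8⟩
      · exact Or.inl h8
    · rintro (h7 | h7)
      · subst h7; exact ⟨hi, Or.inr rfl⟩
      · exact ⟨h7.1, Or.inl h7.2⟩
  unfold rowBound rowLength
  omega

end SkipComposition

/-! ### Semistandard skyline fillings as multiline queues. -/

namespace SkylineFilling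

variable {n : ℕ} {γ : Fin n → ℕ}

/-- The entry in row `r + 1` of column `i`, as a number. -/
def value (T : SkylineFilling γ) (r : ℕ) (i : Fin n) : ℕ := T.entry i (r + 1)

/-- The entries in row `r + 1` of the columns of height at least `g`. -/
def level (T : SkylineFilling γ) (g r : ℕ) : Finset ℕ :=
  ({i | g ≤ γ i} : Finset (Fin n)).image (T.value r)

/-- The set of entries in row `r + 1`. -/
def rowSet (T : SkylineFilling γ) (r : ℕ) : Finset ℕ := T.level (r + 1) r

lemma value_eq (T : SkylineFilling γ) {i : Fin n} {r : ℕ} (h : r < γ i) :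
    T.value r i = T i ⟨r, h⟩ := by
  simp [value, entry, h]

lemma cnt_level {T : SkylineFilling γ} {r : ℕ} (hT : Set.InjOn (T.value r) {i | r < γ i}) {g : ℕ}
    (hg : r < g) (v : ℕ) : cnt (T.level g r) v = #{i | g ≤ γ i ∧ T.value r i < v} := by
  rw [level, cnt_image, filter_filter]
  exact hT.mono fun i hi => by
    simp only [coe_filter, mem_univ, true_and, Set.mem_ofPred_eq] at hi ⊢; omega

lemma card_level {T : SkylineFilling γ} {r : ℕ} (hT : Set.InjOn (T.value r) {i | r < γ i}) {g : ℕ}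
    (hg : r ≤ g) : #(T.level (g + 1) r) = rowLength γ g := by
  rw [level, card_image_of_injOn]
  · rfl
  · exact hT.mono fun i hi => by
      simp only [coe_filter, mem_univ, true_and, Set.mem_ofPred_eq] at hi ⊢; omega

section Semistandard

variable {T : SkylineFilling γ} (hT : T.IsSemistandard)
  (hγ : ∀ i j, 0 < γ i → 0 < γ j → i ≤ j → γ i ≤ γ j)

include hT

lemma value_succ_le {i : Fin n} {r : ℕ} (h : r + 1 < γ i) : T.value (r + 1) i ≤ T.value r i :=
  hT.column i (r + 1) h

lemma value_zero_le {i : Fin n} (h : 0 < γ i) : T.value 0 i ≤ n - 1 - i := by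
  have h1 : (T.entry i 1 : ℕ) ≤ T.entry i 0 := hT.column i 0 h
  have h2 : (T.entry i 0 : ℕ) = n - (i + 1) := by rw [entry, Fin.val_rev]
  rw [value, zero_add]
  omega

/-- The basement decreases to the right, and the type A condition carries this up: otherwise the
entry of column `j` would lie between two consecutive entries of column `i`. -/
lemma entry_lt_of_eq {i j : Fin n} (hij : i < j) (h : γ i = γ j) {r : ℕ} (hr : r ≤ γ i) :
    T.entry j r < T.entry i r := by
  induction r with
  | zero => simpa [entry] using hij
  | succ r ih =>
    have h1 := ih (by omega)
    have h2 := hT.typeA i j hij h.ge r (by omega)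
    have h3 := hT.column j r (by omega)
    by_contra h4
    exact h2 ⟨not_lt.1 h4, h3.trans h1.le⟩

lemma value_lt_of_eq {i j : Fin n} (hij : i < j) (h : γ i = γ j) {r : ℕ} (hr : r < γ i) :
    T.value r j < T.value r i := entry_lt_of_eq hT hij h hr

include hγ

/-- Equal entries in columns of different heights would form a type B triple together with the next
entry of the taller column. -/
lemma injOn_value (r : ℕ) : Set.InjOn (T.value r) {i | r < γ i} := by
  have key : ∀ i j, i < j → r < γ i → r < γ j → T.value r i ≠ T.value r j := by
    intro i j hij hi hj he
    rcases (hγ i j (by omega) (by omega) hij.le).eq_or_lt with h | h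
    · exact (value_lt_of_eq hT hij h hi).ne he.symm
    · refine hT.typeB i j hij h (r + 1) hi ⟨?_, (Fin.ext he).le⟩
      rw [show T.entry i (r + 1) = T.entry j (r + 1) from Fin.ext he]
      exact hT.column j (r + 1) (by omega)
  intro i hi j hj he
  rcases lt_trichotomy i j with h | h | h
  · exact absurd he (key i j h hi hj)
  · exact h
  · exact absurd he.symm (key j i h hj hi)

/-- An entry of row `r + 1` that is not in the level belongs to a shorter column, hence to one
further left. The type B condition forbids it from lying between consecutive entries of a taller
column, which is the idleness condition of `serve_unique`. -/
lemma serve_level {r g : ℕ} (hg : r + 1 < g) :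
    serve (T.rowSet r) (T.level g (r + 1)) = T.level g r := by
  have hi := injOn_value hT hγ
  have hle : ∀ v, cnt (T.level g r) v ≤ cnt (T.level g (r + 1)) v := fun v => by
    rw [cnt_level (hi _) (by omega), cnt_level (hi _) hg]
    refine card_le_card fun i => ?_
    simp only [mem_filter, mem_univ, true_and]
    rintro ⟨h1, h2⟩
    exact ⟨h1, (value_succ_le hT (by omega)).trans_lt h2⟩
  refine serve_unique ?_ hle fun v hv hv' => ?_
  · refine image_subset_image fun i => ?_
    simp only [mem_filter, mem_univ, true_and]
    omega
  · refine le_antisymm (hle _) ?_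
    rw [cnt_level (hi _) hg, cnt_level (hi _) (by omega)]
    refine card_le_card fun j => ?_
    simp only [mem_filter, mem_univ, true_and]
    rintro ⟨h1, h2⟩
    refine ⟨h1, ?_⟩
    by_contra h3
    obtain ⟨i, h4, rfl⟩ := mem_image.1 hv
    simp only [mem_filter, mem_univ, true_and] at h4
    have h5 : γ i < g := by
      by_contra h5
      exact hv' (mem_image.2 ⟨i, by simpa using h5, rfl⟩)
    have hij : i < j := by
      by_contra h
      have := hγ j i (by omega) (by omega) (not_lt.1 h)
      omega
    exact hT.typeB i j hij (by omega) (r + 1) h4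
      ⟨Nat.lt_succ_iff.1 h2, (not_lt.1 h3).trans' (Nat.le_succ _)⟩

lemma levelSet_rowSet (r j : ℕ) : levelSet T.rowSet r j = T.level (r + j + 1) r := by
  induction j generalizing r with
  | zero => rfl
  | succ j ih =>
    rw [levelSet, ih, show r + 1 + j + 1 = r + (j + 1) + 1 by omega]
    exact serve_level hT hγ (by omega)

end Semistandard

/-- The row sets determine all levels through the queue, hence by differences the set of entries in
each row of the columns of each height. Columns of equal height have entries decreasing to the
right, so each entry is known by its rank. -/
lemma eq_of_rowSet_eq {T T' : SkylineFilling γ} (hT : T.IsSemistandard) (hT' : T'.IsSemistandard)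
    (hγ : ∀ i j, 0 < γ i → 0 < γ j → i ≤ j → γ i ≤ γ j)
    (h : ∀ r, T.rowSet r = T'.rowSet r) : T = T' := by
  have h' : T.rowSet = T'.rowSet := funext h
  have hl : ∀ r g, r < g → T.level g r = T'.level g r := by
    intro r g hg
    have h1 := levelSet_rowSet hT hγ r (g - 1 - r)
    have h2 := levelSet_rowSet hT' hγ r (g - 1 - r)
    rw [show r + (g - 1 - r) + 1 = g by omega] at h1 h2
    rw [← h1, ← h2, h']
  have hmem : ∀ {T : SkylineFilling γ}, T.IsSemistandard → ∀ {i r}, r < γ i →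
      T.value r i ∈ T.level (γ i) r \ T.level (γ i + 1) r ∧
      cnt (T.level (γ i) r \ T.level (γ i + 1) r) (T.value r i) =
        #{j | γ j = γ i ∧ i < j} := by
    intro T hT i r hr
    have hinj := injOn_value hT hγ r
    refine ⟨mem_sdiff.2 ⟨mem_image_of_mem _ (by simp), fun hm => ?_⟩, ?_⟩
    · obtain ⟨j, h1, h2⟩ := mem_image.1 hm
      simp only [mem_filter, mem_univ, true_and] at h1
      have h3 := hinj (show r < γ j by omega) hr h2
      subst h3
      omega
    · have h1 := cnt_sdiff (A := T.level (γ i) r) (B := T.level (γ i + 1) r)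
        (image_subset_image fun j => by simp only [mem_filter, mem_univ, true_and]; omega)
        (T.value r i)
      rw [cnt_level hinj (by omega), cnt_level hinj hr] at h1
      have h2 : #{j | γ i ≤ γ j ∧ T.value r j < T.value r i} =
          #{j | γ j = γ i ∧ i < j} + #{j | γ i + 1 ≤ γ j ∧ T.value r j < T.value r i} := by
        rw [← card_union_of_disjoint]
        · congr 1
          ext j
          simp only [mem_filter, mem_univ, true_and, mem_union]
          constructor
          · rintro ⟨h2, h3⟩
            rcases h2.eq_or_lt with h4 | h4
            · refine Or.inl ⟨h4.symm, ?_⟩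
              by_contra h5
              rcases (not_lt.1 h5).eq_or_lt with rfl | h5
              · omega
              · have := value_lt_of_eq hT h5 h4.symm (r := r) (by omega)
                omega
            · exact Or.inr ⟨h4, h3⟩
          · rintro (⟨h2, h3⟩ | ⟨h2, h3⟩)
            · exact ⟨h2.ge, value_lt_of_eq hT h3 h2.symm hr⟩
            · exact ⟨by omega, h3⟩
        · rw [disjoint_left]
          intro j
          simp only [mem_filter, mem_univ, true_and]
          omega
      omega
  funext i r
  obtain ⟨h1, h2⟩ := hmem hT r.2
  obtain ⟨h3, h4⟩ := hmem hT' r.2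
  rw [← hl r _ r.2, ← hl r (γ i + 1) (by omega)] at h3 h4
  have h5 := eq_of_cnt_eq h1 h3 (h2.trans h4.symm)
  rw [value_eq T r.2, value_eq T' r.2] at h5
  exact Fin.ext h5

lemma weight_eq {T : SkylineFilling γ} {k : ℕ} (hk : ∀ i, γ i ≤ k)
    (hT : ∀ r, Set.InjOn (T.value r) {i | r < γ i}) (y : ℕ → MvPolynomial (Fin n) ℚ)
    (hy : ∀ i : Fin n, y i = MvPolynomial.X i) :
    T.weight = listWeight y (rowList T.rowSet k) := by
  have h1 : ∀ m, listWeight y (rowList T.rowSet m) = ∏ r ∈ range m, ∏ a ∈ T.rowSet r, y a := by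
    intro m
    induction m with
    | zero => rfl
    | succ m ih =>
      rw [prod_range_succ, ← ih, mul_comm]
      simp [listWeight, rowList]
  have h2 : ∀ r, ∏ a ∈ T.rowSet r, y a =
      ∏ i, if r < γ i then y (T.value r i) else 1 := by
    intro r
    rw [rowSet, level, prod_image, prod_filter]
    · rfl
    · exact (hT r).mono fun i hi => (mem_filter.1 (mem_coe.1 hi)).2
  rw [h1, prod_congr rfl fun r _ => h2 r, prod_comm, weight]
  refine prod_congr rfl fun i _ => ?_
  rw [← prod_filter, show (range k).filter (fun r => r < γ i) = range (γ i) from ?_,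
    ← Fin.prod_univ_eq_prod_range (fun r => y (T.value r i))]
  · refine prod_congr rfl fun r _ => ?_
    rw [value_eq T r.2, hy]
  · ext r
    have := hk i
    simp only [mem_filter, mem_range]
    omega

end SkylineFilling

/-! ### Reconstruction of fillings from queues, and their generating function. -/

namespace SkylineFilling

variable {n : ℕ} {γ : Fin n → ℕ}

/-- Each class is the difference of two nested sets of customers. Adding customers never shortens
the queue, so the services gained never outnumber the arrivals gained. -/
lemma cnt_classSet_le (ρ : ℕ → Finset ℕ) (r j v : ℕ) :
    cnt (levelSet ρ r (j + 1) \ levelSet ρ r (j + 2)) v ≤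
      cnt (levelSet ρ (r + 1) j \ levelSet ρ (r + 1) (j + 1)) v := by
  have h1 := cnt_sdiff (levelSet_succ_subset ρ r (j + 1)) v
  have h2 := cnt_sdiff (levelSet_succ_subset ρ (r + 1) j) v
  have h3 := cnt_serve_add_queue (ρ r) (levelSet ρ (r + 1) j) v
  have h4 := cnt_serve_add_queue (ρ r) (levelSet ρ (r + 1) (j + 1)) v
  have h5 := queue_mono (ρ r) (levelSet_succ_subset ρ (r + 1) j) v
  change cnt (levelSet ρ r (j + 1)) v + _ = _ at h3
  change cnt (levelSet ρ r (j + 2)) v + _ = _ at h4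
  change cnt (levelSet ρ r (j + 1) \ levelSet ρ r (j + 2)) v + cnt (levelSet ρ r (j + 2)) v = _ at h1
  omega

/-- If the entries of a filling enumerate, in each row and each class of columns of the same
height, the elements that the queue assigns to the class, then the filling is semistandard. -/
lemma isSemistandard_of_enumerates {k : ℕ} {T : SkylineFilling γ} {ρ : ℕ → Finset ℕ}
    (hγ : ∀ i j, 0 < γ i → 0 < γ j → i ≤ j → γ i ≤ γ j) (hk : ∀ i, γ i ≤ k)
    (hb : ∀ i g, γ i = g + 1 → n - 1 - i + #{j | γ j = g + 1} =
      rowBound k γ g + #{j | γ j = g + 1 ∧ i < j})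
    (hcard : ∀ r j, #(levelSet ρ r j) = rowLength γ (r + j))
    (hbound : ∀ m < k, ∀ a ∈ levelSet ρ 0 m, a < rowBound k γ m)
    (hmem : ∀ i r, r < γ i →
      T.value r i ∈ levelSet ρ r (γ i - 1 - r) \ levelSet ρ r (γ i - r))
    (hcnt : ∀ i r, r < γ i →
      cnt (levelSet ρ r (γ i - 1 - r) \ levelSet ρ r (γ i - r)) (T.value r i) =
        #{j | γ j = γ i ∧ i < j}) :
    T.IsSemistandard ∧ ∀ r, T.rowSet r = ρ r := by
  have hlt : ∀ i j r, i < j → γ i = γ j → r < γ i → T.value r j < T.value r i := by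
    intro i j r hij h hr
    have h1 := hcnt i r hr
    have h2 := hcnt j r (by omega)
    rw [← h] at h2
    have h3 : #{t | γ t = γ i ∧ j < t} < #{t | γ t = γ i ∧ i < t} := by
      apply card_lt_card
      refine ⟨fun t => ?_, fun hs => ?_⟩
      · simp only [mem_filter, mem_univ, true_and]
        exact fun ⟨h4, h5⟩ => ⟨h4, hij.trans h5⟩
      · have := hs (mem_filter.2 ⟨mem_univ j, h.symm, hij⟩)
        simp at this
    by_contra h4
    have := cnt_mono (levelSet ρ r (γ i - 1 - r) \ levelSet ρ r (γ i - r)) (not_lt.1 h4)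
    omega
  have hinj : ∀ r, Set.InjOn (T.value r) {i | r < γ i} := by
    intro r
    have key : ∀ i j, r < γ i → γ i < γ j → T.value r i ≠ T.value r j := by
      intro i j hi hij he
      have h1 := mem_sdiff.1 (hmem i r hi)
      have h2 := mem_sdiff.1 (hmem j r (by omega))
      rw [← he] at h2
      exact h1.2 (levelSet_subset ρ r (by omega) h2.1)
    intro i hi j hj he
    rcases lt_trichotomy (γ i) (γ j) with h | h | h
    · exact absurd he (key i j hi h)
    · rcases lt_trichotomy i j with h' | h' | h'
      · exact absurd he.symm (hlt i j r h' h hi).ne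
      · exact h'
      · exact absurd he (hlt j i r h' h.symm hj).ne
    · exact absurd he.symm (key j i hj h)
  have hlevel : ∀ r j, T.level (r + j + 1) r = levelSet ρ r j := by
    intro r j
    refine eq_of_subset_of_card_le (fun a ha => ?_) ?_
    · obtain ⟨i, h1, rfl⟩ := mem_image.1 ha
      simp only [mem_filter, mem_univ, true_and] at h1
      exact levelSet_subset ρ r (by omega) (mem_sdiff.1 (hmem i r (by omega))).1
    · rw [card_level (hinj r) (by omega), hcard]
  have hcol : ∀ i r, r + 1 < γ i → T.value (r + 1) i ≤ T.value r i := by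
    intro i r hr
    have h1 := hcnt i r (by omega)
    have h2 := hcnt i (r + 1) hr
    have h3 := hmem i r (by omega)
    obtain ⟨j, hj⟩ : ∃ j, γ i = j + r + 2 := ⟨γ i - (r + 2), by omega⟩
    rw [show γ i - 1 - r = j + 1 by omega, show γ i - r = j + 2 by omega] at h1 h3
    rw [show γ i - 1 - (r + 1) = j by omega, show γ i - (r + 1) = j + 1 by omega] at h2
    by_contra h4
    -- Both entries have the same rank in their class, so dominance of the classes compares them
    -- directly.
    have h5 := cnt_classSet_le ρ r j (T.value r i + 1)
    rw [cnt_succ, if_pos h3] at h5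
    have h6 := cnt_mono (levelSet ρ (r + 1) j \ levelSet ρ (r + 1) (j + 1))
      (show T.value r i + 1 ≤ T.value (r + 1) i by omega)
    omega
  have hcol' : ∀ i r, r < γ i → T.entry i (r + 1) ≤ T.entry i r := by
    intro i r hr
    cases r with
    | succ r => exact hcol i r hr
    | zero =>
      obtain ⟨g, hg⟩ : ∃ g, γ i = g + 1 := ⟨γ i - 1, by omega⟩
      have h1 := hcnt i 0 hr
      have h2 := hmem i 0 hr
      have h3 := hb i g hg
      have h4 := hk i
      rw [hg] at h1 h2
      simp only [Nat.add_sub_cancel, Nat.sub_zero] at h1 h2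
      -- The entry has a known rank in a set bounded by `rowBound k γ g`, leaving room below the
      -- bound for the larger elements of the class. By `hb` the resulting estimate is exactly the
      -- basement entry.
      have h5 : ∀ a ∈ levelSet ρ 0 g \ levelSet ρ 0 (g + 1), a < rowBound k γ g := fun a ha =>
        hbound g (by omega) a (mem_sdiff.1 ha).1
      have h6 := card_add_le h5 (h5 _ h2).le
      have h7 := card_sdiff_add_card_eq_card (levelSet_succ_subset ρ 0 g)
      have h8 := hcard 0 g
      have h9 := hcard 0 (g + 1)
      rw [zero_add] at h8 h9
      have h10 := rowLength_succ γ g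
      rw [Fin.le_def]
      have h11 : (T.entry i 0 : ℕ) = n - (i + 1) := by rw [entry, Fin.val_rev]
      change T.value 0 i ≤ _
      omega
  refine ⟨⟨hcol', ?_, ?_⟩, ?_⟩
  · rintro i j hij hle r hr ⟨h1, -⟩
    have h2 := hγ i j (by omega) (by omega) hij.le
    exact absurd h1 (not_le.2 (hlt i j r hij (by omega) (by omega)))
  · rintro i j hij hlt' r hr ⟨h1, h2⟩
    cases r with
    | zero =>
      simp only [entry, Fin.rev_le_rev] at h2
      exact absurd h2 (not_le.2 hij)
    | succ r =>
      obtain ⟨g, hg⟩ : ∃ g, γ j = r + 1 + g + 1 := ⟨γ j - (r + 2), by omega⟩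
      set v := T.value r i with hv
      change T.value (r + 1) j ≤ v at h1
      change v ≤ T.value r j at h2
      have h3 := mem_sdiff.1 (hmem i r hr)
      have h4 : v ∉ levelSet ρ r (g + 1) := fun h =>
        h3.2 (levelSet_subset ρ r (by omega) h)
      have h5 : v ∈ ρ r := levelSet_subset ρ r (Nat.zero_le _) h3.1
      rw [levelSet] at h4
      obtain ⟨h6, h7⟩ := cnt_serve_eq h5 h4
      change cnt (levelSet ρ r (g + 1)) v = _ at h6
      rw [← hlevel, ← hlevel, cnt_level (hinj _) (by omega),
        cnt_level (hinj _) (by omega)] at h6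
      have h8 : T.value (r + 1) j ∈ levelSet ρ (r + 1) g := by
        rw [← hlevel]
        exact mem_image_of_mem _ (by simp [hg])
      have h9 : T.value (r + 1) j < v := lt_of_le_of_ne h1 (by rintro h; rw [← h] at h7; exact h7 h8)
      -- Since `v` is idle for these columns, as many of their entries lie below `v` in one row as
      -- in the next. Weak decrease up the columns gives an inclusion, so the sets of columns
      -- coincide, and column `j` would have its lower entry below `v` as well.
      have h10 : ({t | r + (g + 1) + 1 ≤ γ t ∧ T.value r t < v} : Finset (Fin n)) =
          ({t | r + 1 + g + 1 ≤ γ t ∧ T.value (r + 1) t < v} : Finset (Fin n)) := by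
        refine eq_of_subset_of_card_le (fun t => ?_) h6.ge
        simp only [mem_filter, mem_univ, true_and]
        rintro ⟨h11, h12⟩
        exact ⟨by omega, (hcol t r (by omega)).trans_lt h12⟩
      have h11 : j ∈ ({t | r + (g + 1) + 1 ≤ γ t ∧ T.value r t < v} : Finset (Fin n)) := by
        rw [h10]
        exact mem_filter.2 ⟨mem_univ _, hg.ge, h9⟩
      have := (mem_filter.1 h11).2.2
      omega
  · intro r
    exact hlevel r 0

lemma exists_isSemistandard {k : ℕ} {ρ : ℕ → Finset ℕ}
    (hγ : ∀ i j, 0 < γ i → 0 < γ j → i ≤ j → γ i ≤ γ j) (hk : ∀ i, γ i ≤ k)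
    (hb : ∀ i g, γ i = g + 1 → n - 1 - i + #{j | γ j = g + 1} =
      rowBound k γ g + #{j | γ j = g + 1 ∧ i < j})
    (hn : rowBound k γ 0 ≤ n)
    (hρ : ∀ m < k, #(ρ m) = rowLength γ m ∧ #(levelSet ρ 0 m) = rowLength γ m ∧
      ∀ a ∈ levelSet ρ 0 m, a < rowBound k γ m) (hρ' : ∀ m, k ≤ m → ρ m = ∅) :
    ∃ T : SkylineFilling γ, T.IsSemistandard ∧ ∀ r, T.rowSet r = ρ r := by
  have hℓ : ∀ m, k ≤ m → rowLength γ m = 0 := fun m hm => by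
    rw [rowLength, card_eq_zero, filter_eq_empty_iff]
    intro i _
    have := hk i
    omega
  have hcard : ∀ r j, #(levelSet ρ r j) = rowLength γ (r + j) := by
    intro r j
    have h1 := card_levelSet_le ρ r j
    have h2 := card_levelSet_zero_le ρ r j
    rcases lt_or_ge (r + j) k with h | h
    · have := hρ _ h; omega
    · rw [hρ' _ h, card_empty] at h1
      have := hℓ _ h
      omega
  have hlt : ∀ m, ∀ a ∈ ρ m, a < n := by
    intro m a ha
    have hm : m < k := by
      by_contra h
      rw [hρ' m (not_lt.1 h)] at ha
      simp at ha
    obtain ⟨h1, h2, h3⟩ := hρ m hm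
    have h4 := passThrough_rowList ρ m 0
    rw [add_zero, levelSet] at h4
    have h5 := bounded_of_passThrough (L := rowList ρ m) (C := ρ m) (b := rowBound k γ m)
      (by rw [h4, h1, h2]) (by rw [h4]; exact h3) a ha
    exact h5.trans_le ((rowBound_antitone k γ (Nat.zero_le m)).trans hn)
  have hspec : ∀ i r, r < γ i →
      #{j | γ j = γ i ∧ i < j} < #(levelSet ρ r (γ i - 1 - r) \ levelSet ρ r (γ i - r)) := by
    intro i r hr
    have h1 := card_sdiff_add_card_eq_card (levelSet_succ_subset ρ r (γ i - 1 - r))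
    rw [hcard, hcard, show r + (γ i - 1 - r) = γ i - 1 by omega,
      show r + (γ i - 1 - r + 1) = γ i - 1 + 1 by omega] at h1
    have h2 := rowLength_succ γ (γ i - 1)
    rw [show γ i - 1 - r + 1 = γ i - r by omega] at h1
    rw [show γ i - 1 + 1 = γ i by omega] at h1 h2
    have h3 : #{j | γ j = γ i ∧ i < j} < #{j | γ j = γ i} := by
      apply card_lt_card
      refine ⟨fun t => ?_, fun hs => ?_⟩
      · simp only [mem_filter, mem_univ, true_and]
        exact fun h => h.1
      · have := hs (mem_filter.2 ⟨mem_univ i, rfl⟩)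
        simp at this
    omega
  let T : SkylineFilling γ := fun i r =>
    ⟨pick (levelSet ρ r (γ i - 1 - r) \ levelSet ρ r (γ i - r)) #{j | γ j = γ i ∧ i < j},
      hlt r _ (levelSet_subset ρ r (Nat.zero_le _)
        (mem_sdiff.1 (pick_spec (hspec i r r.2)).1).1)⟩
  have hT : ∀ i r, r < γ i → T.value r i =
      pick (levelSet ρ r (γ i - 1 - r) \ levelSet ρ r (γ i - r)) #{j | γ j = γ i ∧ i < j} :=
    fun i r hr => by rw [value_eq T hr]
  refine ⟨T, isSemistandard_of_enumerates hγ hk hb hcard (fun m hm => (hρ m hm).2.2) ?_ ?_⟩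
  · intro i r hr
    rw [hT i r hr]
    exact (pick_spec (hspec i r hr)).1
  · intro i r hr
    rw [hT i r hr]
    exact (pick_spec (hspec i r hr)).2

open Classical in
/-- The generating function of semistandard fillings is a flagged Schur polynomial. -/
theorem sum_weight_eq_chainSum {k : ℕ}
    (hγ : ∀ i j, 0 < γ i → 0 < γ j → i ≤ j → γ i ≤ γ j) (hk : ∀ i, γ i ≤ k)
    (hb : ∀ i g, γ i = g + 1 → n - 1 - i + #{j | γ j = g + 1} =
      rowBound k γ g + #{j | γ j = g + 1 ∧ i < j})
    (hn : rowBound k γ 0 ≤ n) (y : ℕ → MvPolynomial (Fin n) ℚ)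
    (hy : ∀ i : Fin n, y i = MvPolynomial.X i) :
    ∑ T : SkylineFilling γ with T.IsSemistandard, T.weight =
      chainSum y (fun i : Fin k => (rowLength γ i : ℤ)) fun i => rowBound k γ i := by
  have hw := rowBound_antitone k γ
  have hq : ∀ T : SkylineFilling γ, T.IsSemistandard →
      IsQueueList (rowLength γ) (rowBound k γ) (rowList T.rowSet k) := by
    intro T hT
    have hinj := injOn_value hT hγ
    rw [isQueueList_rowList]
    intro m hm
    have h1 := levelSet_rowSet hT hγ 0 m
    rw [zero_add] at h1
    refine ⟨card_level (hinj m) le_rfl, ?_, ?_⟩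
    · rw [h1, card_level (hinj 0) (Nat.zero_le _)]
    · rw [h1]
      intro a ha
      obtain ⟨i, h2, rfl⟩ := mem_image.1 ha
      simp only [mem_filter, mem_univ, true_and] at h2
      obtain ⟨g, hg⟩ : ∃ g, γ i = g + 1 := ⟨γ i - 1, by omega⟩
      have h3 := hb i g hg
      have h4 : #{j | γ j = g + 1 ∧ i < j} < #{j | γ j = g + 1} := by
        apply card_lt_card
        refine ⟨fun t => ?_, fun hs => ?_⟩
        · simp only [mem_filter, mem_univ, true_and]
          exact fun h => h.1
        · have := hs (mem_filter.2 ⟨mem_univ i, hg⟩)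
          simp at this
      have h5 := hw (show m ≤ g by omega)
      have h6 := value_zero_le hT (i := i) (by omega)
      omega
  rw [chainSum]
  refine sum_bij (fun T _ (i : Fin k) => (rectify (rowList T.rowSet k)).getD i ∅) ?_ ?_ ?_ ?_
  · intro T hT
    rw [← isChainList_iff_mem_chainSet (by simp)]
    exact isChainList_rectify hw (hq T (mem_filter.1 hT).2)
  · intro T hT T' hT' he
    have hT := (mem_filter.1 hT).2
    have hT' := (mem_filter.1 hT').2
    have h1 : rectify (rowList T.rowSet k) = rectify (rowList T'.rowSet k) := by
      refine List.ext_getElem (by simp) fun i h1 h2 => ?_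
      have h3 := congrFun he ⟨i, by simpa using h1⟩
      simpa only [List.getD_eq_getElem _ _ h1, List.getD_eq_getElem _ _ h2] using h3
    have h2 := eq_of_rowList_eq (rectify_injOn (hq T hT) (hq T' hT') h1)
    refine eq_of_rowSet_eq hT hT' hγ fun r => ?_
    rcases lt_or_ge r k with h | h
    · exact h2 r h
    · have h3 : ∀ T : SkylineFilling γ, T.rowSet r = ∅ := fun T => by
        rw [rowSet, level, image_eq_empty, filter_eq_empty_iff]
        intro i _
        have := hk i
        omega
      rw [h3, h3]
  · intro A hA
    have h1 : IsChainList (rowLength γ) (rowBound k γ) 0 (List.ofFn A) := by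
      rw [isChainList_iff_mem_chainSet List.length_ofFn]
      convert hA using 1
      funext i
      rw [List.getD_eq_getElem _ _ (by simp)]
      simp
    obtain ⟨L, h2, h3⟩ := exists_rectify_eq hw h1
    have h4 : L.length = k := by rw [← length_rectify, h3, List.length_ofFn]
    obtain ⟨ρ, h5, h6⟩ := exists_rowList_eq L
    rw [h4] at h5 h6
    rw [← h5, isQueueList_rowList] at h2
    obtain ⟨T, h7, h8⟩ := exists_isSemistandard hγ hk hb hn h2 h6
    refine ⟨T, mem_filter.2 ⟨mem_univ _, h7⟩, ?_⟩
    funext i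
    rw [show T.rowSet = ρ from funext h8, h5, h3, List.getD_eq_getElem _ _ (by simp)]
    simp
  · intro T hT
    have hT := (mem_filter.1 hT).2
    rw [weight_eq hk (injOn_value hT hγ) y hy, ← listWeight_rectify y (hq T hT), listWeight,
      ← List.prod_ofFn]
    congr 1
    refine List.ext_getElem (by simp) fun i h1 h2 => ?_
    simp only [List.length_map] at h1
    simp

end SkylineFilling

/-! ### Membership of the Demazure characters in the ideal. -/

section Membership

variable {n : ℕ}

lemma revComp_revComp (γ : Fin n → ℕ) : revComp (revComp γ) = γ := by
  funext i; simp [revComp]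

open Classical in
lemma demazureCharacter_revComp (γ : Fin n → ℕ) : demazureCharacter (revComp γ) =
    ∑ T : SkylineFilling γ with T.IsSemistandard, T.weight := by
  have key : ∀ δ : Fin n → ℕ, δ = γ →
      ∑ T : SkylineFilling δ with T.IsSemistandard, T.weight =
        ∑ T : SkylineFilling γ with T.IsSemistandard, T.weight := by
    rintro _ rfl; rfl
  exact key _ (revComp_revComp γ)

/-- The variable with index `a`, as a function of a natural number. -/
noncomputable def varOfNat (n : ℕ) (a : ℕ) : MvPolynomial (Fin n) ℚ :=
  if h : a < n then MvPolynomial.X ⟨a, h⟩ else 0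

lemma varOfNat_val (i : Fin n) : varOfNat n i = MvPolynomial.X i := by simp [varOfNat]

lemma elemSymm_varOfNat (n m : ℕ) :
    elemSymm (varOfNat n) n m = MvPolynomial.esymm (Fin n) ℚ m := by
  rw [elemSymm_natCast, MvPolynomial.esymm]
  have h : range n = (univ : Finset (Fin n)).map Fin.valEmbedding := by
    ext a; simp
  rw [h, powersetCard_map, sum_map]
  refine sum_congr rfl fun A _ => ?_
  simp [varOfNat_val]

lemma rowBound_zero (S : Finset (Fin n)) {k : ℕ} (hk : 0 < k) (hkn : k ≤ n)
    (hS : #S = n - k + 1) : rowBound k (skipComposition S) 0 = n := by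
  rw [rowBound, rowLength_skipComposition_zero, hS]
  omega

lemma demazureCharacter_mem_idealI (S : Finset (Fin n)) {k : ℕ} (hk : 0 < k) (hkn : k ≤ n)
    (hS : #S = n - k + 1) : demazureCharacter (revComp (skipComposition S)) ∈ idealI n k := by
  classical
  rw [demazureCharacter_revComp, SkylineFilling.sum_weight_eq_chainSum
    (fun i j => skipComposition_mono S) (skipComposition_le S hkn hS)
    (fun i g => basement_eq S hkn hS) (rowBound_zero S hk hkn hS).le (varOfNat n) varOfNat_val,
    ← det_flaggedMatrix]
  · rw [Matrix.det_eq_sum_mul_adjugate_row _ ⟨0, hk⟩]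
    -- In the first row the bound is `n` and the size is `n - k + 1`, so the entries are generators
    -- `e_{n-k+1+j}` of the ideal.
    refine Ideal.sum_mem _ fun j _ => Ideal.mul_mem_right _ _ ?_
    have h1 : flaggedMatrix (varOfNat n) (fun i : Fin k => (rowLength (skipComposition S) i : ℤ))
        (fun i => rowBound k (skipComposition S) i) ⟨0, hk⟩ j =
        MvPolynomial.esymm (Fin n) ℚ (n - k + 1 + j) := by
      rw [flaggedMatrix, rowBound_zero S hk hkn hS, rowLength_skipComposition_zero, hS,
        ← elemSymm_varOfNat]
      congr 1
    rw [h1]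
    rcases le_or_gt (n - k + 1 + j) n with h | h
    · exact Ideal.subset_span (Or.inr ⟨_, by omega, h, rfl⟩)
    · rw [MvPolynomial.esymm, powersetCard_eq_empty.2 (by simpa using h), sum_empty]
      exact Ideal.zero_mem _
  · intro i j hij
    exact rowBound_antitone k _ hij
  -- Equality holds here: the summand `k - 1 - r` makes `rowBound` drop by one more than `rowLength`
  -- at each step.
  · intro i j hij
    have := j.2
    simp only [rowBound]
    omega

lemma rename_rev_mem_idealI {k : ℕ} {f : MvPolynomial (Fin n) ℚ} (hf : f ∈ idealI n k) :
    MvPolynomial.rename Fin.rev f ∈ idealI n k := by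
  have h : idealI n k ≤ (idealI n k).comap (MvPolynomial.rename (R := ℚ) (Fin.rev (n := n))) := by
    conv_lhs => rw [idealI]
    rw [Ideal.span_le]
    rintro _ (⟨i, rfl⟩ | ⟨r, h1, h2, rfl⟩)
    · refine Ideal.mem_comap.2 (Ideal.subset_span (Or.inl ⟨i.rev, ?_⟩))
      simp
    · refine Ideal.mem_comap.2 (Ideal.subset_span (Or.inr ⟨r, h1, h2, ?_⟩))
      exact MvPolynomial.rename_esymm (Fin n) ℚ r Fin.revPerm
  exact h hf

lemma reverseDemazureCharacter_mem_idealI (S : Finset (Fin n)) {k : ℕ} (hk : 0 < k)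
    (hkn : k ≤ n) (hS : #S = n - k + 1) :
    reverseDemazureCharacter (revComp (skipComposition S)) ∈ idealI n k :=
  rename_rev_mem_idealI (demazureCharacter_mem_idealI S hk hkn hS)

end Membership

/-! ### Exponents of fillings after reversal of the variables. -/

namespace SkylineFilling

variable {n : ℕ} {γ : Fin n → ℕ}

/-- The exponent of the weight of a filling in the variables `x_n, …, x_1`. -/
noncomputable def exponent (T : SkylineFilling γ) : Fin n →₀ ℕ :=
  ∑ i, ∑ r : Fin (γ i), Finsupp.single (T i r).rev 1

lemma rename_weight (T : SkylineFilling γ) :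
    MvPolynomial.rename Fin.rev T.weight = MvPolynomial.monomial T.exponent (1 : ℚ) := by
  simp_rw [weight, exponent, MvPolynomial.monomial_sum_one, map_prod, MvPolynomial.rename_X]
  rfl

lemma exponent_apply (T : SkylineFilling γ) (v : Fin n) :
    T.exponent v = ∑ i, #{r : Fin (γ i) | (T i r).rev = v} := by
  simp [exponent, Finsupp.finsetSum_apply, Finsupp.single_apply]

lemma exponent_apply_eq_card (T : SkylineFilling γ) (v : Fin n) :
    T.exponent v = #{c : (i : Fin n) × Fin (γ i) | (T c.1 c.2).rev = v} := by
  rw [exponent_apply, card_filter, Fintype.sum_sigma]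
  simp_rw [card_filter]

lemma isSemistandard_rev : IsSemistandard (fun i _ => i.rev : SkylineFilling γ) := by
  have h : ∀ i r, entry (fun i _ => i.rev : SkylineFilling γ) i r = i.rev := by
    rintro i (_ | r) <;> simp [entry]
  refine ⟨fun i r _ => by simp [h], fun i j hij _ r _ => ?_, fun i j hij _ r _ => ?_⟩
  · rintro ⟨h1, -⟩
    rw [h, h, Fin.rev_le_rev] at h1
    exact absurd hij h1.not_gt
  · rintro ⟨-, h1⟩
    rw [h, h, Fin.rev_le_rev] at h1
    exact absurd hij h1.not_gt

lemma exponent_rev :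
    exponent (fun i _ => i.rev : SkylineFilling γ) = Finsupp.equivFunOnFinite.symm γ := by
  ext v
  rw [exponent_apply, sum_eq_single v]
  · simp
  · intro i _ hi
    simp [hi]
  · simp

lemma IsSemistandard.le_rev {T : SkylineFilling γ} (hT : T.IsSemistandard) (i : Fin n)
    (r : Fin (γ i)) : i ≤ (T i r).rev := by
  have key : ∀ r, r < γ i → T.value r i ≤ n - 1 - i := by
    intro r
    induction r with
    | zero => exact value_zero_le hT
    | succ r ih => exact fun h => (value_succ_le hT h).trans (ih (by omega))
  have h := key r r.2
  rw [value_eq T r.2] at h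
  rw [Fin.le_def, Fin.val_rev]
  have := i.2
  have h' : (T i r : ℕ) ≤ n - 1 - i := h
  omega

lemma IsSemistandard.exponent_apply_of_forall_lt {T : SkylineFilling γ} (hT : T.IsSemistandard)
    {v : Fin n} (h : ∀ i < v, ∀ r, T i r = i.rev) :
    T.exponent v = #{r : Fin (γ v) | (T v r).rev = v} := by
  rw [exponent_apply, sum_eq_single v]
  · intro i _ hi
    rw [card_eq_zero, filter_eq_empty_iff]
    intro r _ hr
    rcases hi.lt_or_gt with hi' | hi'
    · rw [h i hi' r, Fin.rev_rev] at hr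
      exact hi hr
    · exact absurd (hT.le_rev i r) (by rw [hr]; exact hi'.not_ge)
  · simp

/-- After reversal the variable `v` comes only from columns up to `v`. At the first column with an
entry different from its basement entry, the exponent drops below the height of the column, and
earlier exponents are the heights. -/
lemma IsSemistandard.exponent_lt {T : SkylineFilling γ} (hT : T.IsSemistandard)
    (hne : T ≠ fun i _ => i.rev) :
    toLex T.exponent < toLex (Finsupp.equivFunOnFinite.symm γ) := by
  classical
  have hex : ({i | ∃ r, T i r ≠ i.rev} : Finset (Fin n)).Nonempty := by
    by_contra h
    rw [not_nonempty_iff_eq_empty, filter_eq_empty_iff] at h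
    refine hne (funext fun i => funext fun r => ?_)
    by_contra h'
    exact h (mem_univ i) ⟨r, h'⟩
  obtain ⟨v, hv, hmin⟩ := exists_min_image _ id hex
  obtain ⟨r, hr⟩ := (mem_filter.1 hv).2
  have hlt : ∀ i < v, ∀ r, T i r = i.rev := fun i hi r => by
    by_contra h
    exact absurd (hmin i (by simpa using ⟨r, h⟩)) hi.not_ge
  rw [Finsupp.Lex.lt_iff]
  refine ⟨v, fun u hu => ?_, ?_⟩
  · change T.exponent u = γ u
    rw [hT.exponent_apply_of_forall_lt fun i hi => hlt i (hi.trans hu)]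
    rw [filter_true_of_mem, card_univ, Fintype.card_fin]
    intro r _
    rw [hlt u hu r, Fin.rev_rev]
  · change T.exponent v < γ v
    rw [hT.exponent_apply_of_forall_lt hlt]
    conv_rhs => rw [← Fintype.card_fin (γ v), ← card_univ]
    refine card_lt_card (filter_ssubset.2 ⟨r, mem_univ r, fun h => hr ?_⟩)
    rw [← Fin.rev_rev (T v r), h]

/-- Entries in a row are distinct, so a variable occurs at most once per row, and only in rows
reached by a column up to `v`. -/
lemma IsSemistandard.exponent_apply_le {T : SkylineFilling γ} (hT : T.IsSemistandard)
    (hγ : ∀ i j, 0 < γ i → 0 < γ j → i ≤ j → γ i ≤ γ j) {v : Fin n} {b : ℕ}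
    (hb : ∀ i ≤ v, γ i ≤ b) : T.exponent v ≤ b := by
  rw [exponent_apply_eq_card, ← card_range b]
  have hval : ∀ c : (i : Fin n) × Fin (γ i), (T c.1 c.2).rev = v →
      T.value c.2 c.1 = v.rev := fun c hc => by
    rw [value_eq T c.2.2, ← hc, Fin.rev_rev]
  refine card_le_card_of_injOn (fun c => (c.2 : ℕ)) (fun c hc => ?_) fun c hc c' hc' he => ?_
  · have hc := (mem_filter.1 hc).2
    exact mem_coe.2 (mem_range.2 (c.2.2.trans_le (hb _ (hc ▸ hT.le_rev c.1 c.2))))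
  · have h := hval c (mem_filter.1 hc).2
    have h' := hval c' (mem_filter.1 hc').2
    obtain ⟨i, r⟩ := c
    obtain ⟨j, s⟩ := c'
    change (r : ℕ) = s at he
    have hij : i = j := by
      refine injOn_value hT hγ r r.2 (show (r : ℕ) < γ j by rw [he]; exact s.2) ?_
      rw [h, he, h']
    subst hij
    rw [Fin.ext he]

lemma IsSemistandard.sum_exponent_le {T : SkylineFilling γ} (hT : T.IsSemistandard) (v : Fin n) :
    ∑ u with u ≤ v, T.exponent u ≤ ∑ i with i ≤ v, γ i := by
  simp_rw [exponent_apply]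
  rw [sum_comm, ← sum_filter_add_sum_filter_not univ (· ≤ v), add_eq_left.2]
  · refine sum_le_sum fun i _ => ?_
    rw [← card_biUnion]
    · exact (card_le_univ _).trans_eq (Fintype.card_fin _)
    · intro a _ b _ hab
      rw [Function.onFun, disjoint_left]
      intro r hr hr'
      exact hab ((mem_filter.1 hr).2.symm.trans (mem_filter.1 hr').2)
  · refine sum_eq_zero fun i hi => sum_eq_zero fun u hu => ?_
    rw [card_eq_zero, filter_eq_empty_iff]
    intro r _ hr
    exact (mem_filter.1 hi).2 ((hT.le_rev i r).trans (hr ▸ (mem_filter.1 hu).2))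

end SkylineFilling

/-! ### Leading monomials and non-divisibility between characters. -/

section LeadingMonomial

variable {n : ℕ} (S : Finset (Fin n))

open Classical in
lemma reverseDemazureCharacter_revComp (γ : Fin n → ℕ) :
    reverseDemazureCharacter (revComp γ) =
      ∑ T : SkylineFilling γ with T.IsSemistandard, MvPolynomial.monomial T.exponent 1 := by
  rw [reverseDemazureCharacter, demazureCharacter_revComp, map_sum]
  exact sum_congr rfl fun T _ => T.rename_weight

lemma exists_of_mem_support_reverseDemazureCharacter {γ : Fin n → ℕ} {d : Fin n →₀ ℕ}
    (hd : d ∈ (reverseDemazureCharacter (revComp γ)).support) :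
    ∃ T : SkylineFilling γ, T.IsSemistandard ∧ T.exponent = d := by
  classical
  rw [reverseDemazureCharacter_revComp, MvPolynomial.mem_support_iff, MvPolynomial.coeff_sum] at hd
  obtain ⟨T, hT, h⟩ := exists_ne_zero_of_sum_ne_zero hd
  refine ⟨T, (mem_filter.1 hT).2, ?_⟩
  rw [MvPolynomial.coeff_monomial] at h
  by_contra h'
  exact h (if_neg h')

lemma coeff_reverseDemazureCharacter (γ : Fin n → ℕ) :
    (reverseDemazureCharacter (revComp γ)).coeff (Finsupp.equivFunOnFinite.symm γ) = 1 := by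
  classical
  rw [reverseDemazureCharacter_revComp, MvPolynomial.coeff_sum,
    sum_eq_single (fun i _ => i.rev : SkylineFilling γ)]
  · rw [MvPolynomial.coeff_monomial, if_pos SkylineFilling.exponent_rev]
  · intro T hT hne
    rw [MvPolynomial.coeff_monomial, if_neg]
    intro h
    have := SkylineFilling.IsSemistandard.exponent_lt (mem_filter.1 hT).2 hne
    rw [h] at this
    exact lt_irrefl _ this
  · intro h
    exact absurd (mem_filter.2 ⟨mem_univ _, SkylineFilling.isSemistandard_rev⟩) h

lemma reverseDemazureCharacter_ne_zero (γ : Fin n → ℕ) :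
    reverseDemazureCharacter (revComp γ) ≠ 0 := fun h => by
  have := coeff_reverseDemazureCharacter γ
  rw [h, MvPolynomial.coeff_zero] at this
  exact zero_ne_one this

lemma degree_reverseDemazureCharacter (γ : Fin n → ℕ) :
    MonomialOrder.lex.degree (reverseDemazureCharacter (revComp γ)) =
      Finsupp.equivFunOnFinite.symm γ := by
  refine MonomialOrder.lex.toSyn.injective (le_antisymm ?_ ?_)
  · rw [MonomialOrder.degree_le_iff]
    intro d hd
    obtain ⟨T, hT, rfl⟩ := exists_of_mem_support_reverseDemazureCharacter hd
    by_cases hne : T = fun i _ => i.rev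
    · rw [hne, SkylineFilling.exponent_rev]
    · exact (MonomialOrder.lex_lt_iff.2 (hT.exponent_lt hne)).le
  · refine MonomialOrder.le_degree (MvPolynomial.mem_support_iff.2 ?_)
    rw [coeff_reverseDemazureCharacter]
    exact one_ne_zero

lemma leadingCoeff_reverseDemazureCharacter (γ : Fin n → ℕ) :
    MonomialOrder.lex.leadingCoeff (reverseDemazureCharacter (revComp γ)) = 1 := by
  rw [MonomialOrder.leadingCoeff, degree_reverseDemazureCharacter, coeff_reverseDemazureCharacter]

/-- The exponent of the leading monomial of the reverse Demazure character of `S`. -/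
noncomputable def skipExponent : Fin n →₀ ℕ := Finsupp.equivFunOnFinite.symm (skipComposition S)

variable {S}

lemma skipComposition_le_add_one_sub {T : Finset (Fin n)} {i v : Fin n} (h : i ≤ v) :
    skipComposition T i + #{t ∈ T | t < v} ≤ v + 1 := by
  by_cases hi : i ∈ T
  · have h1 := skipComposition_of_mem T hi
    have h2 := card_filter_lt_le T h
    have h3 : (i : ℕ) ≤ v := h
    omega
  · rw [skipComposition, if_neg hi]
    have h2 := card_filter_lt_le T (i := ⟨0, by have := v.2; omega⟩) (j := v) (Fin.le_def.2 (Nat.zero_le _))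
    have h3 : #{t ∈ T | t < (⟨0, by have := v.2; omega⟩ : Fin n)} = 0 := by
      rw [card_eq_zero, filter_eq_empty_iff]
      intro t _ ht
      exact absurd (Fin.lt_def.1 ht) (by simp)
    rw [h3] at h2
    simp at h2
    omega

lemma skipComposition_lt {k : ℕ} (hk : 0 < k) (hkn : k ≤ n) (hS : #S = n - k + 1)
    (hS' : ∀ i ∈ S, (i : ℕ) + 1 ≤ n - 1) (i : Fin n) : skipComposition S i < k := by
  by_cases hi : i ∈ S
  · have h0 : 0 < n := i.pos
    have h1 := skipComposition_of_mem S hi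
    have h2 := card_filter_lt_le S (i := i) (j := ⟨n - 1, by omega⟩)
      (Fin.le_def.2 (by have := hS' i hi; simp; omega))
    have h3 : {t ∈ S | t < (⟨n - 1, by omega⟩ : Fin n)} = S := filter_true_of_mem fun t ht =>
      Fin.lt_def.2 (by have := hS' t ht; simp; omega)
    rw [h3] at h2
    simp at h2
    omega
  · rw [skipComposition, if_neg hi]
    exact hk

lemma apply_le_of_mem_support {d : Fin n →₀ ℕ}
    (hd : d ∈ (reverseDemazureCharacter (revComp (skipComposition S))).support) (v : Fin n) :
    d v + #{t ∈ S | t < v} ≤ v + 1 := by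
  obtain ⟨T, hT, rfl⟩ := exists_of_mem_support_reverseDemazureCharacter hd
  have h0 := skipComposition_le_add_one_sub (T := S) (le_refl v)
  have := hT.exponent_apply_le (fun i j => skipComposition_mono S) (v := v)
    (b := v + 1 - #{t ∈ S | t < v}) fun i hi => by
      have := skipComposition_le_add_one_sub (T := S) hi
      omega
  omega

lemma apply_lt_of_mem_support {k : ℕ} (hk : 0 < k) (hkn : k ≤ n) (hS : #S = n - k + 1)
    (hS' : ∀ i ∈ S, (i : ℕ) + 1 ≤ n - 1) {d : Fin n →₀ ℕ}
    (hd : d ∈ (reverseDemazureCharacter (revComp (skipComposition S))).support) (v : Fin n) :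
    d v < k := by
  obtain ⟨T, hT, rfl⟩ := exists_of_mem_support_reverseDemazureCharacter hd
  have := hT.exponent_apply_le (fun i j => skipComposition_mono S) (v := v) (b := k - 1)
    fun i _ => Nat.le_sub_one_of_lt (skipComposition_lt hk hkn hS hS' i)
  omega

lemma skipComposition_congr {S S' : Finset (Fin n)} {u : Fin n} (h : ∀ i ≤ u, i ∈ S ↔ i ∈ S') :
    skipComposition S u = skipComposition S' u := by
  have : {t ∈ S | t < u} = {t ∈ S' | t < u} := by
    ext t
    simp only [mem_filter]
    exact ⟨fun ht => ⟨(h t ht.2.le).1 ht.1, ht.2⟩, fun ht => ⟨(h t ht.2.le).2 ht.1, ht.2⟩⟩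
  simp only [skipComposition, h u le_rfl, this]

/-- Let `v` be the first element at which `S` and `S'` differ. If `v ∈ S`, equality of sizes gives a
next element `w` of `S'`; fewer elements of `S'` than of `S` precede `w`, so the part of `S'` at `w`
exceeds the bound `apply_le_of_mem_support` for `d w`. If `v ∈ S'`, the parts of `S'` up to `v` have
a larger sum than those of `S`, which bounds the corresponding sum of exponents of `d`. -/
lemma eq_of_skipExponent_le {S' : Finset (Fin n)} (hcard : #S = #S') {d : Fin n →₀ ℕ}
    (hd : d ∈ (reverseDemazureCharacter (revComp (skipComposition S))).support)
    (hle : skipExponent S' ≤ d) : S = S' := by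
  by_contra hne
  obtain ⟨v, hv, hmin⟩ := exists_min_image (symmDiff S S') id
    (nonempty_iff_ne_empty.2 fun h => hne (symmDiff_eq_bot.1 h))
  have hlt : ∀ i < v, (i ∈ S ↔ i ∈ S') := fun i hi => by
    by_contra h
    have : i ∈ symmDiff S S' := by rw [mem_symmDiff]; tauto
    exact absurd (hmin i this) hi.not_ge
  have hle' : ∀ u, skipComposition S' u ≤ d u := hle
  rcases mem_symmDiff.1 hv with ⟨h1, h2⟩ | ⟨h1, h2⟩
  · have hc1 : #{t ∈ S' | t ≤ v} < #{t ∈ S | t ≤ v} := by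
      refine card_lt_card ⟨fun t => ?_, fun h => ?_⟩
      · simp only [mem_filter]
        rintro ⟨h3, h4⟩
        exact ⟨(hlt t (h4.lt_of_ne (by rintro rfl; exact h2 h3))).2 h3, h4⟩
      · exact h2 (mem_filter.1 (h (mem_filter.2 ⟨h1, le_rfl⟩))).1
    have hex : ({t ∈ S' | v < t} : Finset (Fin n)).Nonempty := by
      by_contra h
      rw [not_nonempty_iff_eq_empty, filter_eq_empty_iff] at h
      have : {t ∈ S' | t ≤ v} = S' := filter_true_of_mem fun t ht => not_lt.1 (h ht)
      rw [this, ← hcard] at hc1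
      exact absurd (card_filter_le S (· ≤ v)) hc1.not_ge
    obtain ⟨w, hw, hwmin⟩ := exists_min_image _ id hex
    obtain ⟨hwS, hvw⟩ := mem_filter.1 hw
    have h3 : {t ∈ S' | t < w} = {t ∈ S' | t ≤ v} := by
      refine filter_congr fun t ht => ⟨fun h => ?_, fun h => h.trans_lt hvw⟩
      by_contra h'
      exact absurd (hwmin t (mem_filter.2 ⟨ht, not_le.1 h'⟩)) h.not_ge
    have h4 : #{t ∈ S | t ≤ v} ≤ #{t ∈ S | t < w} :=
      card_le_card (monotone_filter_right _ fun t _ h => h.trans_lt hvw)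
    have h5 := skipComposition_of_mem S' hwS
    have h6 := apply_le_of_mem_support hd w
    have h7 := hle' w
    rw [h3] at h5
    omega
  · obtain ⟨T, hT, rfl⟩ := exists_of_mem_support_reverseDemazureCharacter hd
    have h3 := hT.sum_exponent_le v
    have h4 : ∑ i with i ≤ v, skipComposition S i < ∑ i with i ≤ v, skipComposition S' i := by
      refine sum_lt_sum (fun i hi => ?_) ⟨v, by simp, ?_⟩
      · rcases (mem_filter.1 hi).2.lt_or_eq with h | rfl
        · exact (skipComposition_congr fun j hj => hlt j (hj.trans_lt h)).le
        · rw [skipComposition, if_neg h2]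
          exact Nat.zero_le _
      · rw [skipComposition, if_neg h2]
        exact (skipComposition_pos S').2 h1
    have h5 := sum_le_sum fun i (_ : i ∈ ({i | i ≤ v} : Finset (Fin n))) => hle' i
    omega

end LeadingMonomial

/-! ### Counting the monomials avoided by the proposed leading monomials. -/

section Counting

variable {n m k : ℕ}

/-- The state `z` advances on reading a letter `c ≤ z` and is kept on reading a letter `c > z`. -/
def advance (z c : ℕ) : ℕ := if c ≤ z then z + 1 else z

/-- The state reached from `z` by reading the word `a`. -/
def finalState (z : ℕ) (a : Fin m → Fin k) : ℕ :=
  (List.ofFn fun i => (a i : ℕ)).foldl advance z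

/-- The number of letters that do not occur in `a`. -/
def missing (a : Fin m → Fin k) : ℕ := #{c | ∀ i, a i ≠ c}

lemma finalState_cons (z : ℕ) (c : Fin k) (a : Fin m → Fin k) :
    finalState z (Fin.cons c a : Fin (m + 1) → Fin k) = finalState (advance z c) a := by
  simp [finalState, List.ofFn_succ]

lemma le_finalState (z : ℕ) (a : Fin m → Fin k) : z ≤ finalState z a := by
  induction m generalizing z with
  | zero => simp [finalState]
  | succ m ih =>
    rw [← Fin.cons_self_tail a, finalState_cons]
    refine le_trans ?_ (ih _ _)
    rw [advance]
    split_ifs <;> omega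

lemma missing_le (a : Fin m → Fin k) : missing a ≤ k :=
  (card_le_univ _).trans_eq (Fintype.card_fin k)

lemma missing_cons (c : Fin k) (a : Fin m → Fin k) :
    missing (Fin.cons c a : Fin (m + 1) → Fin k) =
      if ∀ i, a i ≠ c then missing a - 1 else missing a := by
  have h : ({b | ∀ i, (Fin.cons c a : Fin (m + 1) → Fin k) i ≠ b} : Finset (Fin k)) =
      ({b | ∀ i, a i ≠ b} : Finset (Fin k)).erase c := by
    ext b
    simp [Fin.forall_fin_succ, eq_comm]
  rw [missing, h]
  split_ifs with hc
  · exact card_erase_of_mem (by simpa using hc)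
  · rw [erase_eq_of_notMem (by simpa using hc), missing]

lemma card_filter_cons (p : (Fin (m + 1) → Fin k) → Prop) [DecidablePred p] :
    #{a | p a} = ∑ c : Fin k, #{a : Fin m → Fin k | p (Fin.cons c a)} := by
  simp_rw [card_filter]
  rw [← (Fin.consEquiv fun _ => Fin k).sum_comp, Fintype.sum_prod_type]
  rfl

lemma card_filter_finalState_succ {z : ℕ} (hz : z < k) :
    #{a : Fin (m + 1) → Fin k | k ≤ finalState z a} =
      (z + 1) * #{a : Fin m → Fin k | k ≤ finalState (z + 1) a} +
        (k - 1 - z) * #{a : Fin m → Fin k | k ≤ finalState z a} := by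
  rw [card_filter_cons, ← sum_filter_add_sum_filter_not univ fun c : Fin k => (c : ℕ) ≤ z]
  have h1 : #{c : Fin k | (c : ℕ) ≤ z} = z + 1 := by
    rw [← Fin.card_Iic ⟨z, hz⟩]
    congr 1
    ext c
    simp [Fin.le_def]
  have h2 : #{c : Fin k | ¬(c : ℕ) ≤ z} = k - 1 - z := by
    have := card_filter_add_card_filter_not (s := (univ : Finset (Fin k))) fun c => (c : ℕ) ≤ z
    rw [h1, card_univ, Fintype.card_fin] at this
    omega
  congr 1
  · refine (sum_eq_card_nsmul (b := #{a : Fin m → Fin k | k ≤ finalState (z + 1) a})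
      fun c hc => ?_).trans (by rw [h1, smul_eq_mul])
    simp_rw [finalState_cons, advance, if_pos (mem_filter.1 hc).2]
  · refine (sum_eq_card_nsmul (b := #{a : Fin m → Fin k | k ≤ finalState z a})
      fun c hc => ?_).trans (by rw [h2, smul_eq_mul])
    simp_rw [finalState_cons, advance, if_neg (mem_filter.1 hc).2]

/-- A tail missing at most `z` letters may be preceded by any of the `k` letters, and one missing
exactly `z + 1` only by one of those. This is the recursion of `card_filter_finalState_succ`, where
`z + 1` letters advance the state and `k - 1 - z` keep it. -/
lemma card_filter_missing_succ {z : ℕ} (hz : z < k) :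
    #{a : Fin (m + 1) → Fin k | missing a ≤ z} =
      (z + 1) * #{a : Fin m → Fin k | missing a ≤ z + 1} +
        (k - 1 - z) * #{a : Fin m → Fin k | missing a ≤ z} := by
  rw [card_filter_cons]
  simp_rw [card_filter]
  rw [sum_comm, mul_sum, mul_sum, ← sum_add_distrib]
  refine sum_congr rfl fun a _ => ?_
  simp_rw [missing_cons]
  rcases lt_trichotomy (missing a) (z + 1) with h | h | h
  · rw [sum_congr rfl fun c _ => if_pos (by split_ifs <;> omega), if_pos (by omega),
      if_pos (by omega)]
    simp
    omega
  · rw [if_pos h.le, if_neg (by omega), ← card_filter, mul_one, mul_zero, add_zero, ← h]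
    refine congrArg card ?_
    ext c
    simp only [mem_filter, mem_univ, true_and]
    constructor
    · intro h'
      by_contra hc
      rw [if_neg hc] at h'
      omega
    · intro hc
      rw [if_pos hc]
      omega
  · rw [if_neg (by omega), if_neg (by omega), mul_zero, mul_zero]
    refine sum_eq_zero fun c _ => if_neg ?_
    split_ifs <;> omega

lemma card_filter_finalState (m k z : ℕ) :
    #{a : Fin m → Fin k | k ≤ finalState z a} = #{a : Fin m → Fin k | missing a ≤ z} := by
  rcases le_or_gt k z with hz | hz
  · rw [filter_true_of_mem fun a _ => hz.trans (le_finalState z a),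
      filter_true_of_mem fun a _ => (missing_le a).trans hz]
  · induction m generalizing z with
    | zero => simp [finalState, missing]
    | succ m ih =>
      rw [card_filter_finalState_succ hz, card_filter_missing_succ hz, ih z hz]
      rcases Nat.lt_or_ge (z + 1) k with h | h
      · rw [ih _ h]
      · rw [filter_true_of_mem fun a _ => h.trans (le_finalState (z + 1) a),
          filter_true_of_mem fun a _ => (missing_le a).trans h]

/-- The state reached from `0` by reading the first `i` letters of `a`. -/
def stateAt (a : Fin n → Fin k) (i : ℕ) : ℕ :=
  ((List.ofFn fun i => (a i : ℕ)).take i).foldl advance 0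

lemma stateAt_succ (a : Fin n → Fin k) (i : Fin n) :
    stateAt a (i + 1) = advance (stateAt a i) (a i) := by
  rw [stateAt, List.take_add_one, List.foldl_append, stateAt]
  simp

lemma card_filter_add_stateAt (a : Fin n → Fin k) {i : ℕ} (hi : i ≤ n) :
    #{t : Fin n | stateAt a t < a t ∧ (t : ℕ) < i} + stateAt a i = i := by
  induction i with
  | zero => simp [stateAt]
  | succ i ih =>
    have h1 := stateAt_succ a ⟨i, hi⟩
    have h2 := ih (by omega)
    have h3 : ({t : Fin n | stateAt a t < a t ∧ (t : ℕ) < i + 1} : Finset (Fin n)) =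
        if stateAt a i < a ⟨i, hi⟩ then
          insert ⟨i, hi⟩ ({t : Fin n | stateAt a t < a t ∧ (t : ℕ) < i} : Finset (Fin n))
        else ({t : Fin n | stateAt a t < a t ∧ (t : ℕ) < i} : Finset (Fin n)) := by
      split_ifs with h
      · ext t
        simp only [mem_filter, mem_univ, true_and, mem_insert]
        constructor
        · rintro ⟨h4, h5⟩
          rcases Nat.lt_succ_iff_lt_or_eq.1 h5 with h6 | h6
          · exact Or.inr ⟨h4, h6⟩
          · exact Or.inl (Fin.ext h6)
        · rintro (rfl | ⟨h4, h5⟩)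
          · exact ⟨h, Nat.lt_succ_self _⟩
          · exact ⟨h4, by omega⟩
      · ext t
        simp only [mem_filter, mem_univ, true_and]
        constructor
        · rintro ⟨h4, h5⟩
          refine ⟨h4, (Nat.lt_succ_iff.1 h5).lt_of_ne fun h6 => h ?_⟩
          subst h6
          exact h4
        · rintro ⟨h4, h5⟩
          exact ⟨h4, by omega⟩
    rw [h3]
    dsimp only [advance] at h1
    split_ifs with h4
    · rw [if_neg (by omega)] at h1
      rw [card_insert_of_notMem (by simp), h1]
      omega
    · rw [if_pos (by omega)] at h1
      omega

/-- The state counts the positions passed without a skip, so at a skipped position the part of the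
skip composition is the state plus one, which is at most the letter there. If the final state is
below `k`, at least `n - k + 1` positions are skipped, and the first `n - k + 1` of them form a set
`S` with `x^γ(S)` dividing the monomial. -/
lemma le_finalState_of_forall_not_skipComposition_le (hkn : k ≤ n) {a : Fin n → Fin k}
    (h : ∀ S : Finset (Fin n), (∀ i ∈ S, (i : ℕ) + 1 ≤ n - 1) → #S = n - k + 1 →
      ¬∀ i, skipComposition S i ≤ a i) : k ≤ finalState 0 a := by
  have hfin : finalState 0 a = stateAt a n := by
    rw [finalState, stateAt, List.take_of_length_le (by simp)]
  by_contra hlt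
  rw [hfin, not_le] at hlt
  have hn := card_filter_add_stateAt a le_rfl
  have hex : ∃ i, n - k + 1 ≤ #{t : Fin n | stateAt a t < a t ∧ (t : ℕ) < i} := ⟨n, by omega⟩
  classical
  set j := Nat.find hex with hj
  have hj1 : n - k + 1 ≤ #{t : Fin n | stateAt a t < a t ∧ (t : ℕ) < j} := Nat.find_spec hex
  have hjn : j ≤ n := Nat.find_min' hex (by omega)
  have hj0 : 0 < j := by
    by_contra h0
    have : j = 0 := by omega
    simp [this] at hj1
  have hj2 : #{t : Fin n | stateAt a t < a t ∧ (t : ℕ) < j} = n - k + 1 := by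
    have h1 := card_filter_add_stateAt a hjn
    have h2 := card_filter_add_stateAt a (i := j - 1) (by omega)
    have h3 := not_le.1 (Nat.find_min hex (m := j - 1) (by omega))
    have h4 := stateAt_succ a ⟨j - 1, by omega⟩
    simp only [Nat.sub_add_cancel hj0] at h4
    have h5 : stateAt a (j - 1) ≤ stateAt a j := by
      rw [h4, advance]
      split_ifs <;> omega
    omega
  have hskip : ∀ i ∈ ({t : Fin n | stateAt a t < a t ∧ (t : ℕ) < j} : Finset (Fin n)),
      skipComposition ({t : Fin n | stateAt a t < a t ∧ (t : ℕ) < j} : Finset (Fin n)) i =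
        stateAt a i + 1 := by
    intro i hi
    have h1 := skipComposition_of_mem _ hi
    have h2 := card_filter_add_stateAt a i.2.le
    rw [filter_filter] at h1
    have h3 : ({t : Fin n | (stateAt a t < a t ∧ (t : ℕ) < j) ∧ t < i} : Finset (Fin n)) =
        ({t : Fin n | stateAt a t < a t ∧ (t : ℕ) < i} : Finset (Fin n)) := by
      have hij := (mem_filter.1 hi).2.2
      refine filter_congr fun t _ => ?_
      rw [Fin.lt_def]
      constructor
      · rintro ⟨⟨h4, -⟩, h5⟩
        exact ⟨h4, h5⟩
      · rintro ⟨h4, h5⟩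
        exact ⟨⟨h4, by omega⟩, h5⟩
    rw [h3] at h1
    omega
  refine h _ (fun i hi => ?_) hj2 fun i => ?_
  -- At most `n - k` skips precede `i`, and its state is at most `k - 2` because a letter below `k`
  -- exceeds it; the sum of the two is `i`, so `i ≤ n - 2`.
  · have h1 := card_filter_add_stateAt a i.2.le
    have h2 := (mem_filter.1 hi).2
    have h3 := (a i).2
    have h4 : #{t : Fin n | stateAt a t < a t ∧ (t : ℕ) < i} < n - k + 1 :=
      not_le.1 (Nat.find_min hex (m := i) h2.2)
    by_contra h5
    have := i.2
    omega
  · by_cases hi : i ∈ ({t : Fin n | stateAt a t < a t ∧ (t : ℕ) < j} : Finset (Fin n))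
    · rw [hskip i hi]
      exact (mem_filter.1 hi).2.1
    · rw [skipComposition, if_neg hi]
      exact Nat.zero_le _

lemma missing_eq_zero_iff (a : Fin m → Fin k) : missing a = 0 ↔ Function.Surjective a := by
  rw [missing, card_eq_zero, filter_eq_empty_iff]
  simp [Function.Surjective]

open Classical in
lemma card_nonskip_le (hkn : k ≤ n) :
    #{a : Fin n → Fin k | ∀ S : Finset (Fin n), (∀ i ∈ S, (i : ℕ) + 1 ≤ n - 1) →
      #S = n - k + 1 → ¬∀ i, skipComposition S i ≤ a i} ≤
    #{a : Fin n → Fin k | Function.Surjective a} := by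
  calc _ ≤ #{a : Fin n → Fin k | k ≤ finalState 0 a} :=
        card_le_card (monotone_filter_right _ fun a _ h =>
          le_finalState_of_forall_not_skipComposition_le hkn h)
    _ = #{a : Fin n → Fin k | missing a ≤ 0} := card_filter_finalState n k 0
    _ = _ := by simp_rw [Nat.le_zero, missing_eq_zero_iff]

end Counting

/-! ### Lowering degrees on the points given by surjective words. -/

section Points

open MvPolynomial

variable {n k : ℕ}

/-- Evaluation of polynomials at the points of `{0, …, k-1}^n` all of whose coordinate values
`0, …, k-1` occur. -/
noncomputable def evalSurj (n k : ℕ) :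
    MvPolynomial (Fin n) ℚ →ₐ[ℚ] ({y : Fin n → Fin k // Function.Surjective y} → ℚ) :=
  aeval fun i y => ((y.1 i : ℕ) : ℚ)

lemma evalSurj_X (i : Fin n) : evalSurj n k (X i) = fun y => ((y.1 i : ℕ) : ℚ) := aeval_X _ i

/-- The functions on the points that are given by polynomials of total degree less than `D`. -/
noncomputable def lowerSpan (n k D : ℕ) :
    Submodule ℚ ({y : Fin n → Fin k // Function.Surjective y} → ℚ) :=
  Submodule.span ℚ ((fun d : Fin n →₀ ℕ => evalSurj n k (monomial d 1)) '' {d | d.degree < D})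

lemma evalSurj_mem {W : Submodule ℚ ({y : Fin n → Fin k // Function.Surjective y} → ℚ)}
    {f : MvPolynomial (Fin n) ℚ} (h : ∀ d ∈ f.support, evalSurj n k (monomial d 1) ∈ W) :
    evalSurj n k f ∈ W := by
  rw [f.as_sum, map_sum]
  refine W.sum_mem fun d hd => ?_
  rw [← mul_one (coeff d f), ← smul_eq_mul, ← smul_monomial, map_smul]
  exact W.smul_mem _ (h d hd)

lemma evalSurj_mem_lowerSpan_of_isHomogeneous {f : MvPolynomial (Fin n) ℚ} {m D : ℕ}
    (hf : f.IsHomogeneous m) (hm : m < D) : evalSurj n k f ∈ lowerSpan n k D :=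
  evalSurj_mem fun d hd => Submodule.subset_span ⟨d, by
    change d.degree < D
    by_contra h
    exact mem_support_iff.1 hd (hf.coeff_eq_zero (by omega)), rfl⟩

lemma evalSurj_X_mul_mem_lowerSpan (i : Fin n) {D : ℕ}
    {g : {y : Fin n → Fin k // Function.Surjective y} → ℚ} (hg : g ∈ lowerSpan n k D) :
    evalSurj n k (X i) * g ∈ lowerSpan n k (D + 1) := by
  induction hg using Submodule.span_induction with
  | mem _ h =>
    obtain ⟨d, hd, rfl⟩ := h
    rw [← map_mul]
    refine evalSurj_mem_lowerSpan_of_isHomogeneous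
      ((isHomogeneous_X ℚ i).mul (isHomogeneous_monomial 1 rfl)) ?_
    have : d.degree < D := hd
    omega
  | zero => rw [mul_zero]; exact Submodule.zero_mem _
  | add _ _ _ _ h1 h2 => rw [mul_add]; exact Submodule.add_mem _ h1 h2
  | smul c _ _ h => rw [mul_smul_comm]; exact Submodule.smul_mem _ c h

lemma homogeneousComponent_X_mul (i : Fin n) (f : MvPolynomial (Fin n) ℚ) (D : ℕ) :
    homogeneousComponent (D + 1) (X i * f) = X i * homogeneousComponent D f := by
  classical
  ext d
  rw [coeff_homogeneousComponent, coeff_X_mul', coeff_X_mul', coeff_homogeneousComponent]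
  by_cases hi : i ∈ d.support
  · have h1 : d = d - Finsupp.single i 1 + Finsupp.single i 1 := by
      rw [tsub_add_cancel_of_le]
      rw [Finsupp.single_le_iff]
      exact Nat.one_le_iff_ne_zero.2 (Finsupp.mem_support_iff.1 hi)
    have h2 : d.degree = (d - Finsupp.single i 1).degree + 1 := by
      conv_lhs => rw [h1]
      rw [map_add, Finsupp.degree_single]
    simp only [if_pos hi, h2, Nat.add_right_cancel_iff]
  · simp only [if_neg hi, ite_self]

lemma homogeneousComponent_zero_X_mul (i : Fin n) (f : MvPolynomial (Fin n) ℚ) :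
    homogeneousComponent 0 (X i * f) = 0 := by
  classical
  rw [homogeneousComponent_zero, coeff_X_mul', if_neg (by simp), C_0]

/-- The polynomials each of whose homogeneous components agrees on the points with a polynomial of
lower degree. -/
noncomputable def loweringIdeal (n k : ℕ) : Ideal (MvPolynomial (Fin n) ℚ) where
  carrier := {f | ∀ D, evalSurj n k (homogeneousComponent D f) ∈ lowerSpan n k D}
  add_mem' hf hg D := by
    rw [map_add, map_add]
    exact Submodule.add_mem _ (hf D) (hg D)
  zero_mem' D := by
    rw [map_zero, map_zero]
    exact Submodule.zero_mem _
  smul_mem' q f hf := by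
    induction q using MvPolynomial.induction_on with
    | C c =>
      intro D
      rw [smul_eq_mul, homogeneousComponent_C_mul, ← smul_eq_C_mul, map_smul]
      exact Submodule.smul_mem _ c (hf D)
    | add p q hp hq =>
      intro D
      rw [add_smul, map_add, map_add]
      exact Submodule.add_mem _ (hp D) (hq D)
    | mul_X p i hp =>
      intro D
      rw [smul_eq_mul, mul_comm p, mul_assoc]
      cases D with
      | zero =>
        rw [homogeneousComponent_zero_X_mul, map_zero]
        exact Submodule.zero_mem _
      | succ D =>
        rw [homogeneousComponent_X_mul, map_mul]
        exact evalSurj_X_mul_mem_lowerSpan i (hp D)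

lemma mem_loweringIdeal_of_isHomogeneous {f : MvPolynomial (Fin n) ℚ} {m : ℕ}
    (hf : f.IsHomogeneous m) (h : evalSurj n k f ∈ lowerSpan n k m) : f ∈ loweringIdeal n k := by
  intro D
  rw [homogeneousComponent_of_mem hf]
  split_ifs with hD
  · rwa [hD]
  · rw [map_zero]
    exact Submodule.zero_mem _

/-- Each coordinate is a root of the monic polynomial with roots `0, …, k-1`, which expresses its
`k`-th power by lower powers. -/
lemma X_pow_mem_loweringIdeal (i : Fin n) : (X i : MvPolynomial (Fin n) ℚ) ^ k ∈
    loweringIdeal n k := by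
  refine mem_loweringIdeal_of_isHomogeneous (m := k) (isHomogeneous_X_pow i k) ?_
  set p : Polynomial ℚ := ∏ j : Fin k, (Polynomial.X - Polynomial.C ((j : ℕ) : ℚ)) with hp
  have hmonic : p.Monic := Polynomial.monic_prod_X_sub_C _ _
  have hdeg : p.natDegree = k := by
    rw [hp, Polynomial.natDegree_finsetProd_X_sub_C_eq_card, card_univ, Fintype.card_fin]
  have hlead : p.coeff k = 1 := by
    have := hmonic.coeff_natDegree
    rwa [hdeg] at this
  have hsum : evalSurj n k (X i ^ k) =
      ∑ m ∈ range k, (-p.coeff m) • evalSurj n k (X i ^ m) := by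
    funext y
    have h0 : p.eval ((y.1 i : ℕ) : ℚ) = 0 := by
      rw [hp, Polynomial.eval_prod]
      exact prod_eq_zero (mem_univ (y.1 i)) (by simp)
    rw [Polynomial.eval_eq_sum_range, hdeg, sum_range_succ, hlead] at h0
    simp only [map_pow, evalSurj_X, Finset.sum_apply, Pi.smul_apply, Pi.pow_apply, smul_eq_mul,
      neg_mul, sum_neg_distrib]
    linarith
  rw [hsum]
  exact Submodule.sum_mem _ fun m hm => Submodule.smul_mem _ _
    (evalSurj_mem_lowerSpan_of_isHomogeneous (isHomogeneous_X_pow i m) (mem_range.1 hm))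

lemma isHomogeneous_esymm (r : ℕ) : (esymm (Fin n) ℚ r).IsHomogeneous r := by
  refine IsHomogeneous.sum _ _ _ fun A hA => ?_
  have := IsHomogeneous.prod A (fun i => (X i : MvPolynomial (Fin n) ℚ)) (fun _ => 1)
    fun i _ => isHomogeneous_X ℚ i
  rwa [sum_const, smul_eq_mul, mul_one, (mem_powersetCard.1 hA).2] at this

lemma coeff_prod_X_add_C (y : {y : Fin n → Fin k // Function.Surjective y}) {l : ℕ} (hl : l ≤ n) :
    (∏ i, (Polynomial.X + Polynomial.C ((y.1 i : ℕ) : ℚ))).coeff l =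
      evalSurj n k (esymm (Fin n) ℚ (n - l)) y := by
  rw [Finset.prod_X_add_C_coeff _ _ (by simpa using hl), card_univ, Fintype.card_fin, esymm,
    map_sum, Finset.sum_apply]
  refine sum_congr rfl fun A _ => ?_
  rw [map_prod, Finset.prod_apply]
  simp_rw [evalSurj_X]

lemma prod_X_add_C_dvd (y : {y : Fin n → Fin k // Function.Surjective y}) :
    (∏ j : Fin k, (Polynomial.X + Polynomial.C ((j : ℕ) : ℚ))) ∣
      ∏ i, (Polynomial.X + Polynomial.C ((y.1 i : ℕ) : ℚ)) := by
  classical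
  obtain ⟨s, hs⟩ := y.2.hasRightInverse
  have h : ∏ j : Fin k, (Polynomial.X + Polynomial.C ((j : ℕ) : ℚ)) =
      ∏ i ∈ univ.image s, (Polynomial.X + Polynomial.C ((y.1 i : ℕ) : ℚ)) := by
    rw [prod_image fun a _ b _ hab => hs.injective hab]
    exact prod_congr rfl fun j _ => by rw [hs j]
  rw [h]
  exact prod_dvd_prod_of_subset _ _ _ (subset_univ _)

/-- On the points, `∏ (t + y_i)` is divisible by the monic polynomial `p = ∏ (t + j)` of degree `k`.
Since `n - r < k`, the coefficient of `t^(n-r)` in its zero remainder is `e_r` plus a combination of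
the `e_{n-m}` with `m ≥ k`, all of degree at most `n - k < r`. -/
lemma esymm_mem_loweringIdeal (hkn : k ≤ n) {r : ℕ} (h1 : n - k + 1 ≤ r) (h2 : r ≤ n) :
    esymm (Fin n) ℚ r ∈ loweringIdeal n k := by
  refine mem_loweringIdeal_of_isHomogeneous (isHomogeneous_esymm r) ?_
  set p : Polynomial ℚ := ∏ j : Fin k, (Polynomial.X + Polynomial.C ((j : ℕ) : ℚ)) with hp
  have hmonic : p.Monic := Polynomial.monic_prod_of_monic _ _ fun j _ => Polynomial.monic_X_add_C _
  have hdeg : p.degree = k := by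
    simp_rw [hp, Polynomial.degree_prod, Polynomial.degree_X_add_C]
    simp
  have hsum : evalSurj n k (esymm (Fin n) ℚ r) =
      ∑ m ∈ Ico k (n + 1), (-((Polynomial.X ^ m : Polynomial ℚ) %ₘ p).coeff (n - r)) •
        evalSurj n k (esymm (Fin n) ℚ (n - m)) := by
    funext y
    set F : Polynomial ℚ := ∏ i, (Polynomial.X + Polynomial.C ((y.1 i : ℕ) : ℚ)) with hF
    have hFdeg : F.natDegree = n := by
      rw [hF, Polynomial.natDegree_prod_of_monic _ _ fun j _ => Polynomial.monic_X_add_C _]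
      simp_rw [Polynomial.natDegree_X_add_C]
      simp
    have h0 : Polynomial.modByMonicHom p F = 0 :=
      (Polynomial.modByMonic_eq_zero_iff_dvd hmonic).2 (prod_X_add_C_dvd y)
    rw [F.as_sum_range_C_mul_X_pow, hFdeg, map_sum] at h0
    have h3 := congrArg (fun q => Polynomial.coeff q (n - r)) h0
    simp only [← Polynomial.smul_eq_C_mul, map_smul, Polynomial.finsetSum_coeff,
      Polynomial.coeff_smul, Polynomial.coeff_zero, smul_eq_mul] at h3
    rw [range_eq_Ico, ← sum_Ico_consecutive _ (Nat.zero_le k) (by omega), sum_eq_single (n - r)]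
      at h3
    · have h4 : Polynomial.modByMonicHom p (Polynomial.X ^ (n - r)) = Polynomial.X ^ (n - r) := by
        refine (Polynomial.modByMonic_eq_self_iff hmonic).2 ?_
        rw [hdeg, Polynomial.degree_X_pow]
        exact_mod_cast (by omega : n - r < k)
      rw [h4, Polynomial.coeff_X_pow_self, mul_one, hF, coeff_prod_X_add_C y (by omega),
        Nat.sub_sub_self h2] at h3
      rw [eq_neg_of_add_eq_zero_left h3, Finset.sum_apply, ← sum_neg_distrib]
      refine sum_congr rfl fun m hm => ?_
      rw [coeff_prod_X_add_C y (by have := (mem_Ico.1 hm).2; omega), Pi.smul_apply, smul_eq_mul,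
        mul_comm, neg_mul]
      rfl
    · intro m hm hne
      have h4 : Polynomial.modByMonicHom p (Polynomial.X ^ m) = Polynomial.X ^ m := by
        refine (Polynomial.modByMonic_eq_self_iff hmonic).2 ?_
        rw [hdeg, Polynomial.degree_X_pow]
        exact_mod_cast (mem_Ico.1 hm).2
      rw [h4, Polynomial.coeff_X_pow, if_neg hne.symm, mul_zero]
    · intro h
      exact absurd (mem_Ico.2 ⟨Nat.zero_le _, by omega⟩) h
  rw [hsum]
  refine Submodule.sum_mem _ fun m hm => Submodule.smul_mem _ _
    (evalSurj_mem_lowerSpan_of_isHomogeneous (isHomogeneous_esymm _) ?_)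
  have := (mem_Ico.1 hm).1
  omega

lemma idealI_le_loweringIdeal (hkn : k ≤ n) : idealI n k ≤ loweringIdeal n k := by
  rw [idealI, Ideal.span_le]
  rintro _ (⟨i, rfl⟩ | ⟨r, h1, h2, rfl⟩)
  · exact X_pow_mem_loweringIdeal i
  · exact esymm_mem_loweringIdeal hkn h1 h2

end Points

/-! ### Standard monomials span the functions on the points. -/

section StandardMonomials

open MvPolynomial

variable {n k : ℕ}

lemma evalSurj_surjective : Function.Surjective (evalSurj n k) := by
  classical
  intro g
  set e : {y : Fin n → Fin k // Function.Surjective y} → MvPolynomial (Fin n) ℚ := fun y =>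
    ∏ i, ∏ j ∈ univ.erase (y.1 i), (X i - C ((j : ℕ) : ℚ)) with he
  have h : ∀ y y', evalSurj n k (e y) y' = ∏ i, ∏ j ∈ univ.erase (y.1 i),
      (((y'.1 i : ℕ) : ℚ) - ((j : ℕ) : ℚ)) := fun y y' => by
    simp only [he, map_prod, Finset.prod_apply, map_sub, Pi.sub_apply, evalSurj_X, algHom_C]
    rfl
  have h1 : ∀ y, evalSurj n k (e y) y ≠ 0 := fun y => by
    rw [h]
    refine prod_ne_zero_iff.2 fun i _ => prod_ne_zero_iff.2 fun j hj => sub_ne_zero.2 fun h2 => ?_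
    exact ne_of_mem_erase hj (Fin.ext (Nat.cast_injective h2)).symm
  have h2 : ∀ y y', y ≠ y' → evalSurj n k (e y) y' = 0 := fun y y' hne => by
    rw [h]
    obtain ⟨i, hi⟩ := Function.ne_iff.1 (Subtype.coe_injective.ne hne)
    exact prod_eq_zero (mem_univ i)
      (prod_eq_zero (mem_erase.2 ⟨hi.symm, mem_univ _⟩) (sub_self _))
  refine ⟨∑ y, C (g y / evalSurj n k (e y) y) * e y, ?_⟩
  funext y'
  rw [map_sum, Finset.sum_apply, sum_eq_single y']
  · rw [map_mul, Pi.mul_apply, algHom_C]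
    exact div_mul_cancel₀ _ (h1 y')
  · intro y _ hne
    rw [map_mul, Pi.mul_apply, h2 y y' hne, mul_zero]
  · exact fun h => absurd (mem_univ _) h

/-- The span of the functions on the points that are given by standard monomials. -/
noncomputable def standardSpan (n k : ℕ) :
    Submodule ℚ ({y : Fin n → Fin k // Function.Surjective y} → ℚ) :=
  Submodule.span ℚ ((fun d : Fin n →₀ ℕ => evalSurj n k (monomial d 1)) ''
    {d | ∀ f ∈ idealI n k, f ≠ 0 → ¬MonomialOrder.lex.degree f ≤ d})

/-- The induction is on the total degree first and then on the lexicographic order. A nonstandard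
monomial is the leading monomial of an element of the ideal; the homogeneous component containing it
has lower degree on the points, and its other monomials are lexicographically smaller of the same
degree. Degree comes first because lowering it may produce lexicographically larger monomials. -/
lemma evalSurj_monomial_mem_standardSpan (hkn : k ≤ n) (d : Fin n →₀ ℕ) :
    evalSurj n k (monomial d 1) ∈ standardSpan n k := by
  classical
  obtain ⟨D, hD⟩ : ∃ D, d.degree = D := ⟨_, rfl⟩
  induction D using Nat.strong_induction_on generalizing d with
  | _ D ihD =>
    have hlower : lowerSpan n k D ≤ standardSpan n k := by
      refine Submodule.span_le.2 ?_
      rintro _ ⟨e, he, rfl⟩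
      exact ihD _ he e rfl
    induction hs : (MonomialOrder.lex (σ := Fin n)).toSyn d using
      WellFoundedLT.induction generalizing d with
    | _ s ih =>
      by_cases hd : ∀ f ∈ idealI n k, f ≠ 0 → ¬MonomialOrder.lex.degree f ≤ d
      · exact Submodule.subset_span ⟨d, hd, rfl⟩
      · push Not at hd
        obtain ⟨f, hf, hf0, hle⟩ := hd
        set f' := monomial (d - MonomialOrder.lex.degree f) 1 * f with hf'
        have hmem : f' ∈ idealI n k := Ideal.mul_mem_left _ _ hf
        have hdeg : MonomialOrder.lex.degree f' = d := by
          rw [hf', MonomialOrder.degree_mul _ hf0, MonomialOrder.degree_monomial,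
            if_neg one_ne_zero, tsub_add_cancel_of_le hle]
          exact (monomial_eq_zero.not.2 one_ne_zero)
        have hcoeff : coeff d f' ≠ 0 := by
          rw [← hdeg]
          refine (MonomialOrder.lex.coeff_degree_ne_zero_iff).2 (mul_ne_zero ?_ hf0)
          exact (monomial_eq_zero.not.2 one_ne_zero)
        set g := homogeneousComponent D f' with hg
        have hgd : coeff d g = coeff d f' := by rw [hg, coeff_homogeneousComponent, if_pos hD]
        have hgW : evalSurj n k g ∈ standardSpan n k :=
          hlower (idealI_le_loweringIdeal hkn hmem D)
        have hrest : evalSurj n k (g - monomial d (coeff d g)) ∈ standardSpan n k := by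
          refine evalSurj_mem fun e he => ?_
          rw [mem_support_iff, coeff_sub, coeff_monomial] at he
          have hed : d ≠ e := by
            rintro rfl
            rw [if_pos rfl, sub_self] at he
            exact he rfl
          rw [if_neg hed, sub_zero, hg, coeff_homogeneousComponent] at he
          have heD : e.degree = D := by
            by_contra h
            exact he (if_neg h)
          rw [if_pos heD] at he
          refine ih _ ?_ e heD rfl
          rw [← hs, ← hdeg]
          refine (MonomialOrder.le_degree (mem_support_iff.2 he)).lt_of_ne fun h => hed ?_
          rw [← hdeg]
          exact (MonomialOrder.lex.toSyn.injective h).symm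
        have hsub := Submodule.sub_mem _ hgW hrest
        rw [← map_sub, sub_sub_cancel, ← mul_one (coeff d g), ← smul_eq_mul, ← smul_monomial,
          map_smul, hgd] at hsub
        exact (Submodule.smul_mem_iff _ hcoeff).1 hsub

lemma standardSpan_eq_top (hkn : k ≤ n) : standardSpan n k = ⊤ := by
  rw [eq_top_iff]
  intro g _
  obtain ⟨f, rfl⟩ := evalSurj_surjective g
  exact evalSurj_mem fun d _ => evalSurj_monomial_mem_standardSpan hkn d

lemma card_surjective_le_card (hkn : k ≤ n) (B : Finset (Fin n →₀ ℕ))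
    (hB : ∀ d, (∀ f ∈ idealI n k, f ≠ 0 → ¬MonomialOrder.lex.degree f ≤ d) → d ∈ B) :
    Fintype.card {y : Fin n → Fin k // Function.Surjective y} ≤ #B := by
  classical
  rw [← Module.finrank_fintype_fun_eq_card (R := ℚ), ← finrank_top]
  have htop : (⊤ : Submodule ℚ ({y : Fin n → Fin k // Function.Surjective y} → ℚ)) =
      Submodule.span ℚ (B.image fun d => evalSurj n k (monomial d 1)) := by
    rw [eq_comm, eq_top_iff, ← standardSpan_eq_top hkn]
    refine Submodule.span_mono ?_
    rintro _ ⟨d, hd, rfl⟩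
    exact mem_coe.2 (mem_image_of_mem _ (hB d hd))
  rw [htop]
  exact (finrank_span_finset_le_card _).trans card_image_le

end StandardMonomials

/-! ### The Gröbner basis and its reducedness. -/

section Main

open MvPolynomial

variable {n k : ℕ}

lemma groebnerSet_subset_idealI (hk : 0 < k) (hkn : k ≤ n) {g : MvPolynomial (Fin n) ℚ}
    (hg : g ∈ groebnerSet n k) : g ∈ idealI n k := by
  rcases hg with ⟨i, rfl⟩ | ⟨S, -, hS, rfl⟩
  · exact Ideal.subset_span (Or.inl ⟨i, rfl⟩)
  · exact reverseDemazureCharacter_mem_idealI S hk hkn hS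

lemma ne_zero_of_mem_groebnerSet {g : MvPolynomial (Fin n) ℚ} (hg : g ∈ groebnerSet n k) :
    g ≠ 0 := by
  rcases hg with ⟨i, rfl⟩ | ⟨S, -, -, rfl⟩
  · exact pow_ne_zero _ (X_ne_zero i)
  · exact reverseDemazureCharacter_ne_zero _

lemma finite_groebnerSet (n k : ℕ) : (groebnerSet n k).Finite := by
  refine (Set.finite_range _).union (Set.Finite.subset (Set.finite_range
    fun S : Finset (Fin n) => reverseDemazureCharacter (revComp (skipComposition S))) ?_)
  rintro _ ⟨S, -, -, rfl⟩
  exact ⟨S, rfl⟩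

lemma degree_X_pow (i : Fin n) :
    MonomialOrder.lex.degree ((X i : MvPolynomial (Fin n) ℚ) ^ k) = Finsupp.single i k := by
  classical
  rw [X_pow_eq_monomial, MonomialOrder.degree_monomial, if_neg one_ne_zero]

/-- Standard monomials avoid all proposed leading monomials. If the leading monomial of `f` avoided
them too without being standard, there would be fewer standard monomials than surjections. -/
lemma exists_mem_groebnerSet_degree_le (hk : 0 < k) (hkn : k ≤ n) {f : MvPolynomial (Fin n) ℚ}
    (hf : f ∈ idealI n k) (hf0 : f ≠ 0) :
    ∃ g ∈ groebnerSet n k, MonomialOrder.lex.degree g ≤ MonomialOrder.lex.degree f := by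
  classical
  by_contra! hcon
  set A : Finset (Fin n → Fin k) := {a | ∀ S : Finset (Fin n),
    (∀ i ∈ S, (i : ℕ) + 1 ≤ n - 1) → #S = n - k + 1 → ¬∀ i, skipComposition S i ≤ a i} with hA
  set φ : (Fin n → Fin k) → (Fin n →₀ ℕ) := fun a =>
    Finsupp.equivFunOnFinite.symm fun i => (a i : ℕ) with hφ
  have hmem : ∀ d : Fin n →₀ ℕ,
      (∀ g ∈ groebnerSet n k, ¬MonomialOrder.lex.degree g ≤ d) → d ∈ A.image φ := by
    intro d hd
    have hlt : ∀ i, d i < k := fun i => by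
      by_contra h
      refine hd _ (Or.inl ⟨i, rfl⟩) ?_
      rw [degree_X_pow, Finsupp.single_le_iff]
      exact not_lt.1 h
    refine mem_image.2 ⟨fun i => ⟨d i, hlt i⟩, mem_filter.2 ⟨mem_univ _, fun S h1 h2 h3 => ?_⟩, ?_⟩
    · refine hd _ (Or.inr ⟨S, h1, h2, rfl⟩) ?_
      rw [degree_reverseDemazureCharacter]
      exact h3
    · ext i
      rfl
  have h1 := card_surjective_le_card hkn ((A.image φ).erase (MonomialOrder.lex.degree f))
    fun d hd => mem_erase.2 ⟨fun h => hd f hf hf0 h.ge, hmem d fun g hg =>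
      hd g (groebnerSet_subset_idealI hk hkn hg) (ne_zero_of_mem_groebnerSet hg)⟩
  have h2 := card_erase_lt_of_mem (hmem _ hcon)
  have h3 : #(A.image φ) ≤ #A := card_image_le
  have h4 := card_nonskip_le (n := n) (k := k) hkn
  rw [Fintype.card_subtype] at h1
  rw [hA] at h3
  exact absurd (h1.trans_lt (h2.trans_le (h3.trans h4))) (lt_irrefl _)

lemma isGroebnerBasis_groebnerSet (hk : 0 < k) (hkn : k ≤ n) :
    IsGroebnerBasis MonomialOrder.lex (idealI n k) (groebnerSet n k) where
  finite := finite_groebnerSet n k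
  mem _ := groebnerSet_subset_idealI hk hkn
  ne_zero _ := ne_zero_of_mem_groebnerSet
  span_initial := by
    refine le_antisymm (Ideal.span_le.2 ?_) (Ideal.span_mono (Set.image_mono fun g hg =>
      ⟨groebnerSet_subset_idealI hk hkn hg, ne_zero_of_mem_groebnerSet hg⟩))
    rintro _ ⟨f, ⟨hf, hf0⟩, rfl⟩
    obtain ⟨g, hg, hle⟩ := exists_mem_groebnerSet_degree_le hk hkn hf hf0
    have h : initialMonomial MonomialOrder.lex f =
        monomial (MonomialOrder.lex.degree f - MonomialOrder.lex.degree g) 1 *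
          initialMonomial MonomialOrder.lex g := by
      rw [initialMonomial, initialMonomial, monomial_mul, tsub_add_cancel_of_le hle, one_mul]
    rw [h]
    exact Ideal.mul_mem_left _ _ (Ideal.subset_span ⟨g, hg, rfl⟩)

lemma mem_support_X_pow {i : Fin n} {d : Fin n →₀ ℕ}
    (hd : d ∈ ((X i : MvPolynomial (Fin n) ℚ) ^ k).support) : d = Finsupp.single i k := by
  rw [X_pow_eq_monomial] at hd
  exact mem_singleton.1 (support_monomial_subset hd)

lemma not_degree_le_of_mem_support (hk : 0 < k) (hkn : k < n) {g h : MvPolynomial (Fin n) ℚ}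
    (hg : g ∈ groebnerSet n k) (hh : h ∈ groebnerSet n k) (hne : g ≠ h) {d : Fin n →₀ ℕ}
    (hd : d ∈ h.support) : ¬MonomialOrder.lex.degree g ≤ d := by
  classical
  rcases hg with ⟨i, rfl⟩ | ⟨S, hS', hS, rfl⟩ <;> rcases hh with ⟨j, rfl⟩ | ⟨S₂, hS₂', hS₂, rfl⟩
  · have hij : j ≠ i := by
      rintro rfl
      exact hne rfl
    change ¬MonomialOrder.lex.degree (X i ^ k) ≤ d
    rw [mem_support_X_pow hd, degree_X_pow, Finsupp.single_le_iff, Finsupp.single_eq_of_ne hij.symm]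
    exact hk.not_ge
  · change ¬MonomialOrder.lex.degree (X i ^ k) ≤ d
    rw [degree_X_pow, Finsupp.single_le_iff]
    exact (apply_lt_of_mem_support hk hkn.le hS₂ hS₂' hd i).not_ge
  · rw [mem_support_X_pow hd, degree_reverseDemazureCharacter]
    intro hle
    -- Here `k < n` matters: `S` has at least two elements, so `x^γ(S)` involves a variable other
    -- than `x_j`. For `k = n` the monomial is a power of a single variable and divides its `k`-th
    -- power.
    obtain ⟨i, hi, hij⟩ := exists_mem_ne (s := S) (by omega) j
    have h1 : skipComposition S i ≤ Finsupp.single j k i := hle i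
    rw [Finsupp.single_eq_of_ne hij] at h1
    exact absurd ((skipComposition_pos S).2 hi) h1.not_gt
  · rw [degree_reverseDemazureCharacter]
    intro hle
    refine hne ?_
    rw [eq_of_skipExponent_le (hS₂.trans hS.symm) hd hle]

end Main

theorem mainTheorem3 (n k : ℕ) (hk : 0 < k) (hkn : k ≤ n) :
    IsGroebnerBasis (MonomialOrder.lex (σ := Fin n)) (idealI n k) (groebnerSet n k) ∧
      (k < n →
        IsReducedGroebnerBasis (MonomialOrder.lex (σ := Fin n)) (idealI n k)
          (groebnerSet n k)) := by
  refine ⟨isGroebnerBasis_groebnerSet hk hkn, fun hkn' =>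
    ⟨isGroebnerBasis_groebnerSet hk hkn, ?_, fun g hg h hh hne d hd =>
      not_degree_le_of_mem_support hk hkn' hg hh hne hd⟩⟩
  rintro _ (⟨i, rfl⟩ | ⟨S, -, -, rfl⟩)
  · change MonomialOrder.lex.leadingCoeff (MvPolynomial.X i ^ k) = 1
    rw [MvPolynomial.X_pow_eq_monomial, MonomialOrder.leadingCoeff_monomial]
  · exact leadingCoeff_reverseDemazureCharacter _
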